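/- Let $k$ be an odd positive integer, $n=5k$, and $d=2^{4k}+2^{3k}+2^{2k}+2^{k}-1$. Regard $\mathbb{F}_{2^k}$ as a subfield of $\mathbb{F}_{2^n}$. Let $m\in\{k-1,\ \tfrac{k+1}{2},\ 2\}$ with $m\ge 1$ (this excludes only the case $k=1$, $m=k-1=0$), let $\mathcal{L}_1,\mathcal{L}_2$ be affine permutations of $\mathbb{F}_{2^k}$ (bijections that are affine over $\mathbb{F}_2$), and let $g=\mathcal{L}_1\circ x^{2^m-1}\circ\mathcal{L}_2$ on $\mathbb{F}_{2^k}$, extended in any way to a function $g:\mathbb{F}_{2^n}\to\mathbb{F}_{2^n}$ (for example by evaluating a polynomial representing $g$; the function $f$ below does not depend on the extension). Define $$f(x)=g(x)+\bigl(g(x)+x^{d}\bigr)\bigl(x+x^{2^k}\bigr)^{2^n-1},\qquad x\in\mathbb{F}_{2^n}.$$ Then $f$ is a permutation of $\mathbb{F}_{2^n}$, and $f$ is differentially $4$-uniform in the sense that for all $a\in\mathbb{F}_{2^n}\setminus\{0\}$ and $b\in\mathbb{F}_{2^n}$ the equation $f(x+a)+f(x)=b$ has at most $4$ solutions $x\in\mathbb{F}_{2^n}$;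 that is, the differential uniformity $\max_{a\neq 0,\,b}\bigl|\{x\in\mathbb{F}_{2^n}: f(x+a)+f(x)=b\}\bigr|$ of $f$ is at most $4$. -/

import Mathlib

/-- `derivCount f a b` is the number `δ_f(a, b)` of solutions `x` of `f (x + a) + f x = b`
(in characteristic two, `f (x + a) + f x` is the derivative of `f` in direction `a`). -/
noncomputable def derivCount {F : Type*} [Field F] (f : F → F) (a b : F) : ℕ :=
  Nat.card {x : F // f (x + a) + f x = b}

open Classical in
/-- The differential uniformity of `f`: the maximum of `δ_f(a, b)` over all `a ≠ 0` and all `b`. -/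
noncomputable def differentialUniformity {F : Type*} [Field F] [Fintype F] (f : F → F) : ℕ :=
  ((Finset.univ : Finset (F × F)).filter (fun p => p.1 ≠ 0)).sup (fun p => derivCount f p.1 p.2)

/-- A function `f` on a finite field of characteristic two is differentially `δ`-uniform if
`f (x + a) + f x = b` has at most `δ` solutions `x`, for all `a ≠ 0` and all `b`. -/
def IsDifferentiallyUniform {F : Type*} [Field F] [Fintype F] (δ : ℕ) (f : F → F) : Prop :=
  differentialUniformity f ≤ δ

/-- The exponent of the Dobbertin power function on the field with `2 ^ (5 * k)` elements. -/
def dobbertinExp (k : ℕ) : ℕ :=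
  2 ^ (4 * k) + 2 ^ (3 * k) + 2 ^ (2 * k) + 2 ^ k - 1

/-- The function `x ↦ g x + (g x + x ^ d) * (x + x ^ (2 ^ k)) ^ (2 ^ n - 1)` with `n = 5 * k`
and `d` the Dobbertin exponent. -/
def modifiedDobbertin {F : Type*} [Field F] (k : ℕ) (g : F → F) (x : F) : F :=
  g x + (g x + x ^ dobbertinExp k) * (x + x ^ (2 ^ k)) ^ (2 ^ (5 * k) - 1)

/-!
Let `K ⊆ F` be the subfields. Since `d + 2 = 1 + 2 ^ k + 2 ^ (2 * k) + 2 ^ (3 * k) + 2 ^ (4 * k)`,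
the Dobbertin power `x ^ d` equals `N(x) / x ^ 2` with `N` the norm from `F` to `K`. Two distinct
pairs `{x, x + a}`, `{y, y + a}` with the same derivative are four distinct elements `v i` with
`∑ i, v i = 0` and `∑ i, N(v i) / v i ^ 2 = 0`; extracting a square root of the last sum turns it
into `∑ i, a i / v i = 0` with `a i ∈ K` and `a i ^ 2 = N(v i)`. Since `F` has dimension five over
`K`, the six quadratic monomials in `v 0`, `v 1`, `v 2` are linearly dependent, so that the point
`(v 0 : v 1 : v 2)` lies on a conic over `K`. Parametrizing the conic makes the `v i` proportional
to the values at a single `τ ∈ F`, of degree five over `K`, of polynomials `p i` of degree at most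
two, and `N(v i)` becomes a resultant of `p i` with the minimal polynomial of `τ`. That polynomial
divides `∑ i, a i * ∏ j ≠ i, p j`, whose resultants with the `p i` are products of resultants of
pairs of the `p j`; comparing with `a i ^ 2 = N(v i)` contradicts the linear independence of `v 0`,
`v 1`, `v 2`. Hence the Dobbertin power is almost perfect nonlinear, and replacing it on `K` by a
`δ`-uniform permutation of `K` leaves at most two solutions with `x, x + a ∉ K`, and at most `δ`
others: for `a ∈ K` these lie in `K`, and for `a ∉ K` at most one pair `{x, x + a}` meets `K`.
-/

open Polynomial Module

section PrimeDegree

variable {K F : Type*} [Field K] [Field F] [Algebra K F] {τ : F}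

theorem natDegree_minpoly_eq_finrank_of_prime (hp : (finrank K F).Prime)
    (hτ : τ ∉ (algebraMap K F).range) : (minpoly K τ).natDegree = finrank K F := by
  have : FiniteDimensional K F := .of_finrank_pos hp.pos
  have hint : IsIntegral K τ := Algebra.IsIntegral.isIntegral τ
  exact ((Nat.dvd_prime hp).1 (minpoly.degree_dvd hint)).resolve_left
    (minpoly.natDegree_eq_one_iff.not.2 hτ)

theorem eq_zero_of_aeval_eq_zero_of_natDegree_lt (hp : (finrank K F).Prime)
    (hτ : τ ∉ (algebraMap K F).range) {P : K[X]} (hP : P.natDegree < finrank K F)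
    (h : aeval τ P = 0) : P = 0 := by
  rw [← natDegree_minpoly_eq_finrank_of_prime hp hτ] at hP
  exact eq_zero_of_dvd_of_natDegree_lt (minpoly.dvd K τ h) hP

theorem coeffs_eq_zero_of_cubic_eq_zero (hp : (finrank K F).Prime) (hd : 3 < finrank K F)
    (hτ : τ ∉ (algebraMap K F).range) {a b c d : K}
    (h : algebraMap K F a * τ ^ 3 + algebraMap K F b * τ ^ 2 + algebraMap K F c * τ
      + algebraMap K F d = 0) : a = 0 ∧ b = 0 ∧ c = 0 ∧ d = 0 := by
  have hP : aeval τ (Cubic.toPoly ⟨a, b, c, d⟩) = 0 := by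
    simpa only [Cubic.toPoly, map_add, map_mul, map_pow, aeval_C, aeval_X] using h
  have h0 := (Cubic.toPoly_eq_zero_iff _).1
    (eq_zero_of_aeval_eq_zero_of_natDegree_lt hp hτ (natDegree_cubic_le.trans_lt hd) hP)
  exact ⟨congrArg Cubic.a h0, congrArg Cubic.b h0, congrArg Cubic.c h0, congrArg Cubic.d h0⟩

theorem exists_eq_minpoly_mul_of_natDegree_le (hτ : IsIntegral K τ) {P : K[X]} {m : ℕ}
    (hP : P.natDegree ≤ (minpoly K τ).natDegree + m) (h : aeval τ P = 0) :
    ∃ L : K[X], L.natDegree ≤ m ∧ P = minpoly K τ * L := by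
  obtain ⟨L, rfl⟩ := minpoly.dvd K τ h
  refine ⟨L, ?_, rfl⟩
  rcases eq_or_ne L 0 with rfl | hL
  · exact natDegree_zero.le.trans (Nat.zero_le m)
  · rw [natDegree_mul (minpoly.ne_zero hτ) hL] at hP
    omega

theorem norm_aeval_gen_eq_resultant_minpoly [Algebra.IsSeparable K F] (pb : PowerBasis K F)
    {P : K[X]} {m : ℕ} (hP : P.natDegree ≤ m) :
    Algebra.norm K (aeval pb.gen P) = resultant (minpoly K pb.gen) P pb.dim m := by
  classical
  have : FiniteDimensional K F := pb.finite
  let E := AlgebraicClosure K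
  have hnodup : ((minpoly K pb.gen).aroots E).Nodup :=
    nodup_roots (Separable.map (Algebra.IsSeparable.isSeparable K pb.gen))
  apply (algebraMap K E).injective
  rw [Algebra.norm_eq_prod_embeddings K E, ← resultant_map_map, ← pb.natDegree_minpoly,
    ← natDegree_map (algebraMap K E),
    resultant_eq_prod_eval _ _ m (natDegree_map_le.trans hP) (IsAlgClosed.splits _),
    leadingCoeff_map, (minpoly.monic pb.isIntegral_gen).leadingCoeff, map_one, one_pow, one_mul]
  calc ∏ σ : F →ₐ[K] E, σ (aeval pb.gen P)
      = ∏ r : {r // r ∈ (minpoly K pb.gen).aroots E}, eval r.1 (P.map (algebraMap K E)) :=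
        Fintype.prod_equiv pb.liftEquiv' _ _ fun σ => by
          rw [← aeval_algHom_apply, eval_map_algebraMap, pb.liftEquiv'_apply_coe]
    _ = (((minpoly K pb.gen).aroots E).map fun r => eval r (P.map (algebraMap K E))).prod := by
      rw [Finset.prod_mem_multiset _ _ (fun r => eval r (P.map (algebraMap K E))) fun _ => rfl,
        Finset.prod_eq_multiset_prod, Multiset.toFinset_val, hnodup.dedup]

theorem norm_aeval_eq_resultant_minpoly [PerfectField K] (hp : (finrank K F).Prime)
    (hτ : τ ∉ (algebraMap K F).range) {P : K[X]} {m : ℕ} (hP : P.natDegree ≤ m) :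
    Algebra.norm K (aeval τ P) = resultant (minpoly K τ) P (finrank K F) m := by
  have : FiniteDimensional K F := .of_finrank_pos hp.pos
  have hint : IsIntegral K τ := Algebra.IsIntegral.isIntegral τ
  have hτ' := natDegree_minpoly_eq_finrank_of_prime hp hτ
  have hadj : Algebra.adjoin K {τ} = ⊤ := by
    rw [← IntermediateField.adjoin_simple_toSubalgebra_of_isAlgebraic hint.isAlgebraic,
      (Field.primitive_element_iff_minpoly_natDegree_eq K τ).2 hτ',
      IntermediateField.top_toSubalgebra]
  rw [← hτ']
  exact norm_aeval_gen_eq_resultant_minpoly (PowerBasis.ofAdjoinEqTop hint hadj) hP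

end PrimeDegree

section Resultant

variable {R : Type*} [CommRing R]

theorem resultant_mul_right_of_natDegree_le {f g₁ g₂ : R[X]} {m n₁ n₂ : ℕ} (hf : f.natDegree ≤ m)
    (h₁ : g₁.natDegree ≤ n₁) (h₂ : g₂.natDegree ≤ n₂) :
    resultant f (g₁ * g₂) m (n₁ + n₂) = resultant f g₁ m n₁ * resultant f g₂ m n₂ := by
  obtain ⟨k₁, rfl⟩ := Nat.exists_eq_add_of_le h₁
  obtain ⟨k₂, rfl⟩ := Nat.exists_eq_add_of_le h₂
  rw [add_add_add_comm, resultant_add_right_deg _ _ _ _ _ natDegree_mul_le,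
    resultant_add_right_deg _ _ _ _ _ le_rfl, resultant_add_right_deg _ _ _ _ _ le_rfl,
    resultant_mul_right _ _ _ _ hf]
  ring

theorem resultant_prod_right_of_natDegree_le {ι : Type*} (s : Finset ι) {f : R[X]} {g : ι → R[X]}
    {m n : ℕ} (hf : f.natDegree ≤ m) (hg : ∀ i ∈ s, (g i).natDegree ≤ n) :
    resultant f (∏ i ∈ s, g i) m (s.card * n) = ∏ i ∈ s, resultant f (g i) m n := by
  classical
  induction s using Finset.induction_on with
  | empty => rw [Finset.prod_empty, Finset.prod_empty, Finset.card_empty, zero_mul,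
      resultant_one_right, pow_zero]
  | insert i s hi ih =>
    rw [Finset.forall_mem_insert] at hg
    rw [Finset.prod_insert hi, Finset.prod_insert hi, Finset.card_insert_of_notMem hi, add_mul,
      one_mul, add_comm, resultant_mul_right_of_natDegree_le hf hg.1, ih hg.2]
    exact (natDegree_prod_le _ _).trans (Finset.sum_le_card_nsmul _ _ _ hg.2)

theorem resultant_one_one (f g : R[X]) :
    resultant f g 1 1 = f.coeff 1 * g.coeff 0 - f.coeff 0 * g.coeff 1 := by
  have h : sylvester f g 1 1 = !![g.coeff 0, f.coeff 0; g.coeff 1, f.coeff 1] := by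
    ext i j; fin_cases i <;> fin_cases j <;> simp [sylvester, Fin.addCases]
  rw [resultant, h, Matrix.det_fin_two_of]
  ring

variable [CharP R 2]

theorem resultant_two_one (f g : R[X]) :
    resultant f g 2 1 = f.coeff 2 * g.coeff 0 ^ 2 + f.coeff 1 * g.coeff 0 * g.coeff 1
      + f.coeff 0 * g.coeff 1 ^ 2 := by
  have h : sylvester f g 2 1 = !![g.coeff 0, 0, f.coeff 0; g.coeff 1, g.coeff 0, f.coeff 1;
      0, g.coeff 1, f.coeff 2] := by
    ext i j; fin_cases i <;> fin_cases j <;> simp [sylvester, Fin.addCases]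
  rw [resultant, h]
  simp only [Nat.reduceAdd, Matrix.det_fin_three, Matrix.of_apply, Matrix.cons_val]
  grind

theorem resultant_two_two (f g : R[X]) :
    resultant f g 2 2 = (f.coeff 2 * g.coeff 0 + f.coeff 0 * g.coeff 2) ^ 2
      + (f.coeff 2 * g.coeff 1 + f.coeff 1 * g.coeff 2)
        * (f.coeff 1 * g.coeff 0 + f.coeff 0 * g.coeff 1) := by
  have h : sylvester f g 2 2 = !![g.coeff 0, 0, f.coeff 0, 0;
      g.coeff 1, g.coeff 0, f.coeff 1, f.coeff 0;
      g.coeff 2, g.coeff 1, f.coeff 2, f.coeff 1; 0, g.coeff 2, 0, f.coeff 2] := by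
    ext i j; fin_cases i <;> fin_cases j <;> simp [sylvester, Fin.addCases]
  rw [resultant, h, Matrix.det_succ_row_zero]
  simp only [Matrix.det_fin_three, Fin.sum_univ_four, Matrix.of_apply, Matrix.cons_val,
    Matrix.submatrix_apply, Fin.succAbove, Fin.reduceLT, Fin.reduceSucc, Fin.reduceCastSucc,
    Fin.isValue, Fin.coe_ofNat_eq_mod, ↓reduceIte]
  grind

end Resultant

section CayleyQuintic

variable {R : Type*} [CommRing R] {a : Fin 4 → R} {L Z W : R[X]}

/-- The quintic cut out by the Cayley cubic `∑ i, a i / x i = 0` on the conic parametrized by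
`X * L`, `L`, `Z` and `W`, after division by the common factor `L`. -/
noncomputable def cayleyQuintic (a : Fin 4 → R) (L Z W : R[X]) : R[X] :=
  (C (a 0) + C (a 1) * X) * (Z * W) + X * L * (C (a 2) * W + C (a 3) * Z)

theorem cayleyQuintic_swap (a : Fin 4 → R) (L Z W : R[X]) :
    cayleyQuintic (a ∘ Equiv.swap 2 3) L W Z = cayleyQuintic a L Z W := by
  change (C (a 0) + C (a 1) * X) * (W * Z) + X * L * (C (a 3) * Z + C (a 2) * W) = _
  rw [cayleyQuintic]
  ring

theorem natDegree_cayleyQuintic_le (hL : L.natDegree ≤ 1) (hZ : Z.natDegree ≤ 2)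
    (hW : W.natDegree ≤ 2) : (cayleyQuintic a L Z W).natDegree ≤ 5 := by
  unfold cayleyQuintic
  compute_degree
  omega

theorem coeff_zero_cayleyQuintic :
    (cayleyQuintic a L Z W).coeff 0 = a 0 * (Z.coeff 0 * W.coeff 0) := by
  simp [cayleyQuintic, mul_coeff_zero]

theorem coeff_five_cayleyQuintic (hL : L.natDegree ≤ 1) (hZ : Z.natDegree ≤ 2)
    (hW : W.natDegree ≤ 2) :
    (cayleyQuintic a L Z W).coeff 5 = a 1 * (Z.coeff 2 * W.coeff 2) := by
  have hlin : (C (a 0) + C (a 1) * X).natDegree ≤ 1 := by compute_degree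
  have hlow : (X * L * (C (a 2) * W + C (a 3) * Z)).natDegree < 5 := by
    refine Nat.lt_succ_of_le ?_
    compute_degree
    omega
  rw [cayleyQuintic, coeff_add, coeff_eq_zero_of_natDegree_lt hlow, add_zero,
    coeff_mul_add_eq_of_natDegree_le hlin (natDegree_mul_le_of_le hZ hW),
    coeff_mul_add_eq_of_natDegree_le hZ hW]
  simp

theorem coeffs_add_X_add_one_mul (Z : R[X]) (hL : L.natDegree ≤ 1) :
    (Z + (X + 1) * L).coeff 2 = Z.coeff 2 + L.coeff 1 ∧
    (Z + (X + 1) * L).coeff 1 = Z.coeff 1 + L.coeff 0 + L.coeff 1 ∧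
    (Z + (X + 1) * L).coeff 0 = Z.coeff 0 + L.coeff 0 := by
  have : L.coeff 2 = 0 := coeff_eq_zero_of_natDegree_lt (by omega)
  simp [add_mul, this, add_assoc]

theorem coeffs_of_quartic_eq_zero {r s t : R} (hZ : Z.natDegree ≤ 2) (hW : W.natDegree ≤ 2)
    (h : C r * (Z * W) + X * (C s * W + C t * Z) = 0) :
    r * (Z.coeff 2 * W.coeff 2) = 0 ∧
    r * (Z.coeff 2 * W.coeff 1 + Z.coeff 1 * W.coeff 2) + s * W.coeff 2 + t * Z.coeff 2 = 0 ∧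
    r * (Z.coeff 2 * W.coeff 0 + Z.coeff 1 * W.coeff 1 + Z.coeff 0 * W.coeff 2)
      + s * W.coeff 1 + t * Z.coeff 1 = 0 ∧
    r * (Z.coeff 1 * W.coeff 0 + Z.coeff 0 * W.coeff 1) + s * W.coeff 0 + t * Z.coeff 0 = 0 ∧
    r * (Z.coeff 0 * W.coeff 0) = 0 := by
  have hexpand : C r * (Z * W) + X * (C s * W + C t * Z)
      = C (r * (Z.coeff 2 * W.coeff 2)) * X ^ 4
        + C (r * (Z.coeff 2 * W.coeff 1 + Z.coeff 1 * W.coeff 2) + s * W.coeff 2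
          + t * Z.coeff 2) * X ^ 3
        + C (r * (Z.coeff 2 * W.coeff 0 + Z.coeff 1 * W.coeff 1 + Z.coeff 0 * W.coeff 2)
          + s * W.coeff 1 + t * Z.coeff 1) * X ^ 2
        + C (r * (Z.coeff 1 * W.coeff 0 + Z.coeff 0 * W.coeff 1) + s * W.coeff 0
          + t * Z.coeff 0) * X
        + C (r * (Z.coeff 0 * W.coeff 0)) := by
    conv_lhs => rw [eq_quadratic_of_degree_le_two (natDegree_le_iff_degree_le.1 hZ),
      eq_quadratic_of_degree_le_two (natDegree_le_iff_degree_le.1 hW)]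
    simp only [map_add, map_mul]
    ring
  have hc n := congrArg (coeff · n) (hexpand.symm.trans h)
  simp only [coeff_add, coeff_C_mul, coeff_X_pow, coeff_X, coeff_C, coeff_zero] at hc
  exact ⟨by simpa using hc 4, by simpa using hc 3, by simpa using hc 2, by simpa using hc 1,
    by simpa using hc 0⟩

variable [CharP R 2]

theorem resultant_cayleyQuintic (hL : L.natDegree ≤ 1) (hZ : Z.natDegree ≤ 2) :
    resultant L (cayleyQuintic a L Z (Z + (X + 1) * L)) 1 5
      = (a 0 * L.coeff 1 + a 1 * L.coeff 0) * resultant Z L 2 1 ^ 2 := by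
  have hlin : (C (a 0) + C (a 1) * X).natDegree ≤ 1 := by compute_degree
  have hH : ((C (a 0) + C (a 1) * X) * ((X + 1) * Z)
      + X * (C (a 2) * (Z + (X + 1) * L) + C (a 3) * Z)).natDegree + 1 ≤ 5 := by
    refine Nat.succ_le_succ ?_
    compute_degree
    omega
  have hsplit : cayleyQuintic a L Z (Z + (X + 1) * L) = (C (a 0) + C (a 1) * X) * (Z * Z)
      + L * ((C (a 0) + C (a 1) * X) * ((X + 1) * Z)
        + X * (C (a 2) * (Z + (X + 1) * L) + C (a 3) * Z)) := by
    rw [cayleyQuintic]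
    ring
  rw [hsplit, resultant_add_mul_right _ _ _ _ _ hH hL,
    resultant_mul_right_of_natDegree_le hL hlin (natDegree_mul_le_of_le hZ hZ),
    resultant_mul_right_of_natDegree_le hL hZ hZ, resultant_one_one, resultant_comm L Z]
  simp only [CharTwo.neg_eq, CharTwo.sub_eq_add, coeff_add, coeff_C_zero, coeff_C_succ,
    mul_coeff_zero, coeff_mul_X, coeff_X_zero, mul_zero, add_zero, zero_add, one_pow, one_mul]
  ring

theorem resultant_mul_resultant_mul_resultant (hL : L.natDegree ≤ 1) (hZ : Z.natDegree ≤ 2) :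
    resultant Z (X * L) 2 2 * (resultant Z L 2 2 * resultant Z (Z + (X + 1) * L) 2 2)
      = resultant Z L 2 1 ^ 3
        * (Z.coeff 0 * Z.coeff 2 * (Z.coeff 0 + Z.coeff 1 + Z.coeff 2)) := by
  have hX : resultant Z X 2 1 = Z.coeff 0 := by simp [resultant_two_one]
  have hX1 : resultant Z (X + 1) 2 1 = Z.coeff 0 + Z.coeff 1 + Z.coeff 2 := by
    simp only [resultant_two_one, coeff_add, coeff_X_zero, coeff_X_one, coeff_one, one_ne_zero,
      ↓reduceIte, zero_add, add_zero, one_pow, mul_one]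
    ring
  have hL2 : resultant Z L 2 2 = Z.coeff 2 * resultant Z L 2 1 := by
    simpa only [CharTwo.neg_eq, one_pow, one_mul, pow_one] using
      resultant_add_right_deg Z L 2 1 1 hL
  have hXL : resultant Z (X * L) 2 2 = Z.coeff 0 * resultant Z L 2 1 := by
    rw [resultant_mul_right_of_natDegree_le (n₁ := 1) hZ natDegree_X_le hL, hX]
  have hW : resultant Z (Z + (X + 1) * L) 2 2
      = (Z.coeff 0 + Z.coeff 1 + Z.coeff 2) * resultant Z L 2 1 := by
    have hadd := resultant_add_mul_right Z ((X + 1) * L) 1 2 2 (by simp) hZ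
    rw [mul_one, add_comm] at hadd
    rw [hadd, resultant_mul_right_of_natDegree_le (n₁ := 1) hZ (by compute_degree) hL, hX1]
  rw [hXL, hL2, hW]
  ring

variable [IsDomain R]

theorem eq_mul_of_quartic_eq_zero_of_coeff_zero {r s t l₀ l₁ z₁ z₂ : R} (ht : t ≠ 0)
    (hr : r ≠ 0) (hl₀ : l₀ ≠ 0) (hl₁ : l₁ ≠ 0) (hζ : z₂ * l₀ ^ 2 + z₁ * l₀ * l₁ ≠ 0)
    (h₄ : r * (z₂ * (z₂ + l₁)) = 0)
    (h₃ : r * (z₂ * (z₁ + l₀ + l₁) + z₁ * (z₂ + l₁)) + s * (z₂ + l₁) + t * z₂ = 0)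
    (h₂ : r * (z₂ * l₀ + z₁ * (z₁ + l₀ + l₁)) + s * (z₁ + l₀ + l₁) + t * z₁ = 0)
    (h₁ : r * (z₁ * l₀) + s * l₀ = 0) : s = r * l₁ ∧ t = r * l₀ := by
  obtain rfl : s = r * z₁ :=
    mul_right_cancel₀ hl₀ (CharTwo.add_eq_zero.1 (by linear_combination h₁))
  rcases mul_eq_zero.1 ((mul_eq_zero.1 h₄).resolve_left hr) with rfl | hz₂
  · have hz₁ : z₁ = 0 := (mul_eq_zero.1 (by clear h₁ h₃ h₄; grind : t * z₁ = 0)).resolve_left ht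
    exact absurd (by rw [hz₁]; ring) hζ
  · obtain rfl := CharTwo.add_eq_zero.1 hz₂
    obtain rfl : t = r * (z₁ + l₀ + z₂) := by
      refine mul_right_cancel₀ hl₁ ?_
      clear h₁ h₂ h₄
      grind
    have hz₁ : (z₁ + l₀) * (z₁ + z₂) = 0 := by
      refine (mul_eq_zero.1 ?_).resolve_left hr
      clear h₁ h₃ h₄
      grind
    obtain rfl : z₁ = z₂ := CharTwo.add_eq_zero.1 <| (mul_eq_zero.1 hz₁).resolve_left fun e =>
      hζ (by linear_combination l₀ * z₂ * e)
    exact ⟨rfl, by clear h₁ h₂ h₃ h₄; grind⟩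

theorem eq_mul_coeff_of_quartic_eq_zero {r s t : R} (hr : r ≠ 0) (hs : s ≠ 0) (ht : t ≠ 0)
    (hL : L.natDegree ≤ 1) (hZ : Z.natDegree ≤ 2) (hl₀ : L.coeff 0 ≠ 0) (hl₁ : L.coeff 1 ≠ 0)
    (hζ : resultant Z L 2 1 ≠ 0)
    (h : C r * (Z * (Z + (X + 1) * L)) + X * (C s * (Z + (X + 1) * L) + C t * Z) = 0) :
    s = r * L.coeff 1 ∧ t = r * L.coeff 0 ∨ t = r * L.coeff 1 ∧ s = r * L.coeff 0 := by
  obtain ⟨w₂, w₁, w₀⟩ := coeffs_add_X_add_one_mul Z hL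
  obtain ⟨h₄, h₃, h₂, h₁, h₀⟩ := coeffs_of_quartic_eq_zero hZ
    (natDegree_add_le_of_degree_le hZ (by compute_degree; omega)) h
  rw [w₂] at h₄
  rw [w₂, w₁] at h₃
  rw [w₂, w₁, w₀] at h₂
  rw [w₁, w₀] at h₁
  rw [w₀] at h₀
  rw [resultant_two_one] at hζ
  generalize L.coeff 0 = l₀, L.coeff 1 = l₁, Z.coeff 0 = z₀, Z.coeff 1 = z₁, Z.coeff 2 = z₂ at *
  clear h w₂ w₁ w₀
  rcases mul_eq_zero.1 ((mul_eq_zero.1 h₀).resolve_left hr) with rfl | hz₀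
  · exact .inl (eq_mul_of_quartic_eq_zero_of_coeff_zero (z₁ := z₁) (z₂ := z₂) ht hr
      hl₀ hl₁ (by simpa only [zero_mul, add_zero] using hζ) h₄ h₃ (by grind) (by grind))
  · obtain rfl := CharTwo.add_eq_zero.1 hz₀
    exact .inr (eq_mul_of_quartic_eq_zero_of_coeff_zero (z₁ := z₁ + z₀ + l₁) (z₂ := z₂ + l₁) hs hr
      hl₀ hl₁ (fun e => hζ (by clear h₁ h₂ h₃ h₄; grind)) (by clear h₁ h₂ h₃ hζ; grind)
      (by clear h₁ h₂ h₄ hζ; grind) (by clear h₁ h₃ h₄ hζ; grind) (by clear h₂ h₃ h₄ hζ; grind))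

end CayleyQuintic

section NormRelations

variable {K : Type*} [Field K] [CharP K 2] {L Z : K[X]}

theorem exists_eq_linear_mul_of_resultant_eq_zero (hL : L.natDegree ≤ 1) (hZ : Z.natDegree ≤ 2)
    (hL0 : L ≠ 0) (h : resultant Z L 2 1 = 0) : ∃ s t : K, Z = (C s * X + C t) * L := by
  rw [resultant_two_one] at h
  have hLeq := eq_X_add_C_of_natDegree_le_one hL
  have hZeq := eq_quadratic_of_degree_le_two (natDegree_le_iff_degree_le.1 hZ)
  rw [hLeq] at hL0 ⊢
  rw [hZeq]
  generalize L.coeff 0 = l₀, L.coeff 1 = l₁, Z.coeff 0 = z₀, Z.coeff 1 = z₁, Z.coeff 2 = z₂ at *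
  by_cases hl₁ : l₁ = 0
  · subst hl₁
    have hl₀ : l₀ ≠ 0 := by rintro rfl; exact hL0 (by simp)
    obtain rfl : z₂ = 0 := by simpa [hl₀] using h
    refine ⟨z₁ / l₀, z₀ / l₀, ?_⟩
    nth_rw 1 [← div_mul_cancel₀ z₁ hl₀, ← div_mul_cancel₀ z₀ hl₀]
    simp only [map_mul, map_zero]
    ring
  · obtain ⟨s, rfl⟩ : ∃ s, z₂ = s * l₁ := ⟨z₂ / l₁, (div_mul_cancel₀ _ hl₁).symm⟩
    obtain ⟨t, rfl⟩ : ∃ t, z₁ = s * l₀ + t * l₁ :=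
      ⟨(z₁ - s * l₀) / l₁, by rw [div_mul_cancel₀ _ hl₁]; ring⟩
    obtain rfl : z₀ = t * l₀ := by
      refine mul_right_cancel₀ (pow_ne_zero 2 hl₁) ?_
      grind
    refine ⟨s, t, ?_⟩
    simp only [map_add, map_mul]
    ring

theorem eq_and_eq_of_cayleyQuintic_eq_zero {a : Fin 4 → K} (ha : ∀ i, a i ≠ 0)
    (hL : L.natDegree ≤ 1) (hZ : Z.natDegree ≤ 2) (hζ : resultant Z L 2 1 ≠ 0)
    (h : cayleyQuintic a L Z (Z + (X + 1) * L) = 0) :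
    a 0 = a 3 ∧ a 1 = a 2 ∨ a 0 = a 2 ∧ a 1 = a 3 := by
  have hl : a 0 * L.coeff 1 = a 1 * L.coeff 0 := by
    have hres := resultant_cayleyQuintic (a := a) hL hZ
    rw [h, resultant_zero_right, pow_one, zero_mul, eq_comm] at hres
    exact CharTwo.add_eq_zero.1 ((mul_eq_zero.1 hres).resolve_right (pow_ne_zero 2 hζ))
  have hl₁ : L.coeff 1 ≠ 0 := by
    intro e
    rw [e, mul_zero, eq_comm, mul_eq_zero, or_iff_right (ha 1)] at hl
    exact hζ (by rw [resultant_two_one, e, hl]; ring)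
  have hl₀ : L.coeff 0 ≠ 0 := fun e => mul_ne_zero (ha 0) hl₁ (by rw [hl, e, mul_zero])
  obtain ⟨r, hr₁⟩ : ∃ r, a 1 = r * L.coeff 1 := ⟨a 1 / L.coeff 1, (div_mul_cancel₀ _ hl₁).symm⟩
  have hr₀ : a 0 = r * L.coeff 0 := mul_right_cancel₀ hl₁ (by rw [hl, hr₁]; ring)
  have hlinear : C (a 0) + C (a 1) * X = C r * L := by
    conv_rhs => rw [eq_X_add_C_of_natDegree_le_one hL]
    rw [hr₀, hr₁, map_mul, map_mul]
    ring
  have hquartic : C r * (Z * (Z + (X + 1) * L))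
      + X * (C (a 2) * (Z + (X + 1) * L) + C (a 3) * Z) = 0 := by
    refine (mul_eq_zero (a := L).1 (Eq.trans ?_ h)).resolve_left ?_
    · rw [cayleyQuintic, hlinear]
      ring
    · rintro rfl
      exact hl₀ (coeff_zero 0)
  have hr : r ≠ 0 := by rintro rfl; exact ha 1 (by rw [hr₁, zero_mul])
  rcases eq_mul_coeff_of_quartic_eq_zero hr (ha 2) (ha 3) hL hZ hl₀ hl₁ hζ hquartic with
    ⟨e₂, e₃⟩ | ⟨e₃, e₂⟩
  · exact .inl ⟨hr₀.trans e₃.symm, hr₁.trans e₂.symm⟩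
  · exact .inr ⟨hr₀.trans e₂.symm, hr₁.trans e₃.symm⟩

theorem resultant_eq_zero_of_norm_relations {A B c n N M l₀ l₁ z₀ z₁ z₂ ζ : K} (hA : A ≠ 0)
    (hB : B ≠ 0) (hc : c ≠ 0) (hζ : ζ = z₂ * l₀ ^ 2 + z₁ * l₀ * l₁ + z₀ * l₁ ^ 2)
    (normA : A ^ 2 = n * (N * M)) (normB : B ^ 2 = n * M)
    (h₅ : B * (z₂ * (z₂ + l₁)) = c) (h₀ : A * (z₀ * (z₀ + l₀)) = c * N)
    (hl : (A * l₁ + B * l₀) * ζ ^ 2 = c * M)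
    (hz : c ^ 2 = n * ζ ^ 2 * (z₀ * z₂ * (z₀ + z₁ + z₂)))
    (hw : c ^ 2 = n * ζ ^ 2 * ((z₀ + l₀) * (z₂ + l₁) * (z₀ + z₁ + z₂))) : ζ = 0 := by
  have hM : M ≠ 0 := by rintro rfl; simp [hB] at normB
  obtain ⟨hnζ, hz₀₂, hS⟩ : n * ζ ^ 2 ≠ 0 ∧ z₀ * z₂ ≠ 0 ∧ z₀ + z₁ + z₂ ≠ 0 := by
    simpa only [hz, mul_ne_zero_iff (b := z₀ * z₂ * _), mul_ne_zero_iff (b := z₀ + z₁ + z₂)]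
      using pow_ne_zero 2 hc
  have hk : A * l₁ + B * l₀ ≠ 0 := left_ne_zero_of_mul (hl ▸ mul_ne_zero hc hM)
  have hA' : A * c ^ 2 = n * (z₀ * (z₀ + l₀)) * ((A * l₁ + B * l₀) * ζ ^ 2) := by
    refine mul_left_cancel₀ hA ?_
    linear_combination c ^ 2 * normA - n * c * M * h₀ - n * A * (z₀ * (z₀ + l₀)) * hl
  have hB' : B * c ^ 2 = n * (z₂ * (z₂ + l₁)) * ((A * l₁ + B * l₀) * ζ ^ 2) := by
    linear_combination (z₂ * (z₂ + l₁)) * (c * normB - n * hl) - c * B * h₅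
  have hsum : z₀ * (z₀ + l₀) * l₁ + z₂ * (z₂ + l₁) * l₀ = z₀ * z₂ * (z₀ + z₁ + z₂) := by
    refine mul_left_cancel₀ (mul_ne_zero hk hnζ) ?_
    linear_combination (A * l₁ + B * l₀) * hz - l₁ * hA' - l₀ * hB'
  have hprod : z₀ * z₂ = (z₀ + l₀) * (z₂ + l₁) := by
    refine mul_left_cancel₀ (mul_ne_zero hnζ hS) ?_
    linear_combination hw - hz
  have hlin : l₀ + l₁ + z₀ + z₁ + z₂ = 0 := by
    refine (mul_eq_zero.1 ?_).resolve_left hz₀₂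
    clear * - hsum hprod
    grind
  rw [hζ, show z₁ = l₀ + l₁ + z₀ + z₂ by clear * - hlin; grind]
  clear * - hprod
  grind

end NormRelations

section VanishingQuadruple

variable {K F : Type*} [Field K] [Field F] [Algebra K F]

/-- Four distinct nonzero points with sum zero at which the values `N(v i) / v i ^ 2` also have sum
zero. In characteristic two over a perfect field `K` this is the same as the vanishing of
`∑ i, a i / v i`, where `a i` is the square root of `N(v i)`; the roots are part of the data. -/
structure VanishingQuadruple (a : Fin 4 → K) (v : Fin 4 → F) : Prop where
  injective : Function.Injective v
  ne_zero : ∀ i, v i ≠ 0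
  sum_eq_zero : ∑ i, v i = 0
  sq_eq_norm : ∀ i, a i ^ 2 = Algebra.norm K (v i)
  sum_div_eq_zero : ∑ i, algebraMap K F (a i) / v i = 0

theorem exists_perm_apply_eq_of_ne :
    ∀ i j : Fin 4, i ≠ j → ∃ σ : Equiv.Perm (Fin 4), σ 0 = i ∧ σ 1 = j := by
  decide

theorem eq_or_eq_or_eq_of_sum_cubes {R : Type*} [CommRing R] [IsDomain R] [CharP R 2]
    {p q r s : R} (h : p + q + r + s = 0) (h3 : p ^ 3 + q ^ 3 + r ^ 3 + s ^ 3 = 0) :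
    p = q ∨ p = r ∨ q = r := by
  have : (p + q) * ((p + r) * (q + r)) = 0 := by grind
  simpa only [mul_eq_zero, CharTwo.add_eq_zero] using this

namespace VanishingQuadruple

variable {a : Fin 4 → K} {v : Fin 4 → F}

theorem comp_perm (h : VanishingQuadruple a v) (σ : Equiv.Perm (Fin 4)) :
    VanishingQuadruple (a ∘ σ) (v ∘ σ) where
  injective := h.injective.comp σ.injective
  ne_zero i := h.ne_zero (σ i)
  sum_eq_zero := (Equiv.sum_comp σ v).trans h.sum_eq_zero
  sq_eq_norm i := h.sq_eq_norm (σ i)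
  sum_div_eq_zero :=
    (Equiv.sum_comp σ fun i => algebraMap K F (a i) / v i).trans h.sum_div_eq_zero

theorem root_ne_zero [FiniteDimensional K F] (h : VanishingQuadruple a v) (i : Fin 4) :
    a i ≠ 0 := fun hi =>
  h.ne_zero i (Algebra.norm_eq_zero_iff.1 (by rw [← h.sq_eq_norm i, hi, zero_pow two_ne_zero]))

theorem cross_mul_eq_zero (h : VanishingQuadruple a v) :
    algebraMap K F (a 0) * (v 1 * v 2 * v 3) + algebraMap K F (a 1) * (v 0 * v 2 * v 3)
      + algebraMap K F (a 2) * (v 0 * v 1 * v 3) + algebraMap K F (a 3) * (v 0 * v 1 * v 2)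
      = 0 := by
  have := h.sum_div_eq_zero
  have := h.ne_zero 0
  have := h.ne_zero 1
  have := h.ne_zero 2
  have := h.ne_zero 3
  rw [Fin.sum_univ_four] at *
  grind

variable [CharP K 2]

theorem not_forall_mem_range_mul (hd : finrank K F = 5) (h : VanishingQuadruple a v) (x : F)
    (c : Fin 4 → K) : ¬ ∀ i, v i = algebraMap K F (c i) * x := by
  intro hv
  have hx : x ≠ 0 := fun hx => h.ne_zero 0 (by rw [hv, hx, mul_zero])
  have hc (i) : c i ≠ 0 := fun hc => h.ne_zero i (by rw [hv, hc, map_zero, zero_mul])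
  have hinj {i j} (hij : c i = c j) : i = j := h.injective (by rw [hv, hv, hij])
  have : FiniteDimensional K F := .of_finrank_pos (by omega)
  have hN : Algebra.norm K x ≠ 0 := Algebra.norm_ne_zero_iff.2 hx
  have hsum : ∑ i, c i = 0 := by
    apply (algebraMap K F).injective
    have := h.sum_eq_zero
    simp only [hv, ← Finset.sum_mul] at this
    rw [map_sum, (mul_eq_zero.1 this).resolve_right hx, map_zero]
  have hdiv : ∑ i, a i / c i = 0 := by
    apply (algebraMap K F).injective
    have := h.sum_div_eq_zero
    simp only [hv, ← div_div, ← Finset.sum_div] at this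
    simpa [hx] using this
  have hcubes : ∑ i, c i ^ 3 = 0 := by
    have hsq (i) : (a i / c i) ^ 2 = Algebra.norm K x * c i ^ 3 := by
      rw [div_pow, h.sq_eq_norm, hv, map_mul, Algebra.norm_algebraMap, hd]
      have := hc i
      field_simp
    have := CharTwo.sum_sq Finset.univ fun i => a i / c i
    simp only [hdiv, hsq, ← Finset.mul_sum] at this
    simpa [hN] using this
  rw [Fin.sum_univ_four] at hsum hcubes
  rcases eq_or_eq_or_eq_of_sum_cubes hsum hcubes with e | e | e <;> simpa using hinj e

theorem apply_three (h : VanishingQuadruple a v) : v 3 = v 0 + v 1 + v 2 := by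
  have : CharP F 2 := charP_of_injective_algebraMap (algebraMap K F).injective 2
  have := h.sum_eq_zero
  rw [Fin.sum_univ_four] at this
  grind

theorem div_zero_notMem_range (hd : finrank K F = 5) (h : VanishingQuadruple a v) :
    v 1 / v 0 ∉ (algebraMap K F).range := by
  rintro ⟨s, hs⟩
  have : FiniteDimensional K F := .of_finrank_pos (by omega)
  have h0 := h.ne_zero 0
  have h1 : v 1 = algebraMap K F s * v 0 := by rw [hs, div_mul_cancel₀ _ h0]
  have hs0 : s ≠ 0 := by rintro rfl; exact h.ne_zero 1 (by rw [h1, map_zero, zero_mul])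
  have hs1 : 1 + s ≠ 0 := fun e => by
    rw [← CharTwo.add_eq_zero.1 e, map_one, one_mul] at h1
    exact absurd (h.injective h1) (by decide)
  have h3 := h.apply_three
  by_cases hr : v 2 / v 0 ∈ (algebraMap K F).range
  · obtain ⟨t, ht⟩ := hr
    have h2 : v 2 = algebraMap K F t * v 0 := by rw [ht, div_mul_cancel₀ _ h0]
    refine h.not_forall_mem_range_mul hd (v 0) ![1, s, t, 1 + s + t] fun i => ?_
    fin_cases i
    · simp
    · exact h1
    · exact h2
    · simp only [Fin.reduceFinMk, h3, h1, h2, Matrix.cons_val, map_add, map_one]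
      ring
  · have h2 : v 2 = v 2 / v 0 * v 0 := (div_mul_cancel₀ _ h0).symm
    have key : algebraMap K F 0 * (v 2 / v 0) ^ 3 + algebraMap K F (a 0 * s + a 1) * (v 2 / v 0) ^ 2
        + algebraMap K F ((a 0 * s + a 1) * (1 + s) + s * (a 2 + a 3)) * (v 2 / v 0)
        + algebraMap K F (s * a 2 * (1 + s)) = 0 := by
      have hcross := h.cross_mul_eq_zero
      generalize v 2 / v 0 = r at *
      rw [h3, h2, h1] at hcross
      refine (mul_eq_zero.1 ?_).resolve_left (pow_ne_zero 3 h0)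
      simp only [map_add, map_mul, map_one, map_zero]
      linear_combination hcross
    exact mul_ne_zero (mul_ne_zero hs0 (h.root_ne_zero 2)) hs1
      (coeffs_eq_zero_of_cubic_eq_zero (hd ▸ Nat.prime_five) (by omega) hr key).2.2.2

theorem div_notMem_range (hd : finrank K F = 5) (h : VanishingQuadruple a v) {i j : Fin 4}
    (hij : i ≠ j) : v i / v j ∉ (algebraMap K F).range := by
  obtain ⟨σ, rfl, rfl⟩ := exists_perm_apply_eq_of_ne j i hij.symm
  exact (h.comp_perm σ).div_zero_notMem_range hd

theorem smul_ne (hd : finrank K F = 5) (h : VanishingQuadruple a v) {i j : Fin 4}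
    (hij : i ≠ j) (c : K) : c • v j ≠ v i := fun e =>
  h.div_notMem_range hd hij ⟨c, by
    rw [← e, Algebra.smul_def, mul_div_cancel_right₀ _ (h.ne_zero j)]⟩

theorem combination_ne (hd : finrank K F = 5) (h : VanishingQuadruple a v) (s t : K) :
    s • v 1 + t • v 2 ≠ v 0 := by
  intro h0
  have : CharP F 2 := charP_of_injective_algebraMap (algebraMap K F).injective 2
  have : FiniteDimensional K F := .of_finrank_pos (by omega)
  have h3 := h.apply_three
  have hs0 : s ≠ 0 := by
    rintro rfl
    exact h.smul_ne hd (i := 0) (j := 2) (by decide) t (by rw [← h0, zero_smul, zero_add])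
  have hs1 : 1 + s ≠ 0 := fun e => by
    rw [← CharTwo.add_eq_zero.1 e, one_smul] at h0
    refine h.smul_ne hd (i := 3) (j := 2) (by decide) (1 + t) ?_
    rw [h3, ← h0, add_smul, one_smul]
    grind
  have h2 := h.ne_zero 2
  have hr := h.div_notMem_range hd (i := 1) (j := 2) (by decide)
  have h1 : v 1 = v 1 / v 2 * v 2 := (div_mul_cancel₀ _ h2).symm
  have key : algebraMap K F (a 2 * (s * (1 + s))) * (v 1 / v 2) ^ 3
      + algebraMap K F (a 0 * (1 + s) + a 1 * (s * (1 + s)) + a 2 * (s * (1 + t) + t * (1 + s))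
        + a 3 * s) * (v 1 / v 2) ^ 2
      + algebraMap K F (a 0 * (1 + t) + a 1 * (s * (1 + t) + t * (1 + s)) + a 2 * (t * (1 + t))
        + a 3 * t) * (v 1 / v 2)
      + algebraMap K F (a 1 * (t * (1 + t))) = 0 := by
    have hcross := h.cross_mul_eq_zero
    rw [h3, ← h0] at hcross
    simp only [Algebra.smul_def] at hcross
    generalize v 1 / v 2 = r at *
    rw [h1] at hcross
    refine (mul_eq_zero.1 ?_).resolve_left (pow_ne_zero 3 h2)
    simp only [map_add, map_mul, map_one]
    linear_combination hcross
  exact mul_ne_zero (h.root_ne_zero 2) (mul_ne_zero hs0 hs1)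
    (coeffs_eq_zero_of_cubic_eq_zero (hd ▸ Nat.prime_five) (by omega) hr key).1

theorem linearIndependent (hd : finrank K F = 5) (h : VanishingQuadruple a v) :
    LinearIndependent K ![v 0, v 1, v 2] := by
  refine linearIndependent_finCons.2
    ⟨(LinearIndependent.pair_iff' (h.ne_zero 1)).2 fun c => h.smul_ne hd (by decide) c, ?_⟩
  rw [Matrix.range_cons_cons_empty, Submodule.mem_span_pair]
  rintro ⟨s, t, hst⟩
  exact h.combination_ne hd s t hst

theorem not_roots_eq_and_eq (hd : finrank K F = 5) (h : VanishingQuadruple a v) :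
    ¬ (a 0 = a 3 ∧ a 1 = a 2) := by
  rintro ⟨h03, h12⟩
  have : CharP F 2 := charP_of_injective_algebraMap (algebraMap K F).injective 2
  have : FiniteDimensional K F := .of_finrank_pos (by omega)
  have hsum := h.sum_eq_zero
  rw [Fin.sum_univ_four] at hsum
  have hne {i j : Fin 4} (hij : i ≠ j) : v i + v j ≠ 0 := fun e =>
    h.injective.ne hij (CharTwo.add_eq_zero.1 e)
  have ha0 := h.root_ne_zero 0
  have ha1 := h.root_ne_zero 1
  have e1 : algebraMap K F (a 0) * (v 1 * v 2) = algebraMap K F (a 1) * (v 0 * v 3) := by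
    have hcross := h.cross_mul_eq_zero
    rw [← h03, ← h12] at hcross
    refine mul_left_cancel₀ (hne (i := 1) (j := 2) (by decide)) ?_
    grind
  have e2 : a 0 = a 1 := by
    have := congrArg (Algebra.norm K) e1
    simp only [map_mul, Algebra.norm_algebraMap, hd, ← h.sq_eq_norm, ← h03, ← h12] at this
    refine mul_left_cancel₀ (mul_ne_zero (pow_ne_zero 4 ha0) (pow_ne_zero 4 ha1)) ?_
    linear_combination this
  rw [← e2] at e1
  have e3 := mul_left_cancel₀ ((map_ne_zero (algebraMap K F)).2 ha0) e1
  refine mul_ne_zero (hne (i := 0) (j := 1) (by decide)) (hne (i := 0) (j := 2) (by decide)) ?_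
  grind

end VanishingQuadruple

/-- A representation of the points `v i` as values `u * p i τ` of polynomials of degree at most two,
that is, a parametrization `p` of a conic over `K` through the projective point `v`. -/
structure QuadraticParametrization {ι : Type*} (v : ι → F) (p : ι → K[X]) (u τ : F) : Prop where
  natDegree_le : ∀ i, (p i).natDegree ≤ 2
  eq_mul_aeval : ∀ i, v i = u * aeval τ (p i)

/-- The numerator of `∑ i, a i / p i`, whose zeros are the parameters at which the curve
parametrized by `p` meets the cubic surface `∑ i, a i / x i = 0`. -/
noncomputable def cayleyNumerator (a : Fin 4 → K) (p : Fin 4 → K[X]) : K[X] :=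
  ∑ i, C (a i) * ∏ j ∈ Finset.univ.erase i, p j

theorem natDegree_prod_erase_le {p : Fin 4 → K[X]} (hp : ∀ i, (p i).natDegree ≤ 2) (i : Fin 4) :
    (∏ j ∈ Finset.univ.erase i, p j).natDegree ≤ 6 := by
  refine (natDegree_prod_le _ _).trans
    ((Finset.sum_le_card_nsmul _ _ 2 fun j _ => hp j).trans ?_)
  rw [Finset.card_erase_of_mem (Finset.mem_univ i), Finset.card_univ, Fintype.card_fin, smul_eq_mul]

theorem natDegree_cayleyNumerator_le (a : Fin 4 → K) {p : Fin 4 → K[X]}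
    (hp : ∀ i, (p i).natDegree ≤ 2) : (cayleyNumerator a p).natDegree ≤ 6 :=
  natDegree_sum_le_of_forall_le _ _ fun i _ =>
    (natDegree_C_mul_le _ _).trans (natDegree_prod_erase_le hp i)

theorem resultant_cayleyNumerator (a : Fin 4 → K) {p : Fin 4 → K[X]}
    (hp : ∀ i, (p i).natDegree ≤ 2) (i : Fin 4) :
    resultant (p i) (cayleyNumerator a p) 2 6
      = a i ^ 2 * ∏ j ∈ Finset.univ.erase i, resultant (p i) (p j) 2 2 := by
  have hcard (k : Fin 4) : (Finset.univ.erase k).card = 3 := by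
    rw [Finset.card_erase_of_mem (Finset.mem_univ k), Finset.card_univ, Fintype.card_fin]
  have hsplit : cayleyNumerator a p = C (a i) * ∏ j ∈ Finset.univ.erase i, p j
      + p i * ∑ k ∈ Finset.univ.erase i, C (a k) * ∏ j ∈ (Finset.univ.erase k).erase i, p j := by
    rw [cayleyNumerator, ← Finset.add_sum_erase _ _ (Finset.mem_univ i), Finset.mul_sum]
    congr 1
    refine Finset.sum_congr rfl fun k hk => ?_
    rw [← Finset.mul_prod_erase (Finset.univ.erase k) p
      (Finset.mem_erase.2 ⟨(Finset.ne_of_mem_erase hk).symm, Finset.mem_univ i⟩)]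
    ring
  have hdeg : (∑ k ∈ Finset.univ.erase i,
      C (a k) * ∏ j ∈ (Finset.univ.erase k).erase i, p j).natDegree ≤ 4 := by
    refine natDegree_sum_le_of_forall_le _ _ fun k hk => (natDegree_C_mul_le _ _).trans <|
      (natDegree_prod_le _ _).trans ((Finset.sum_le_card_nsmul _ _ 2 fun j _ => hp j).trans ?_)
    rw [Finset.card_erase_of_mem
      (Finset.mem_erase.2 ⟨(Finset.ne_of_mem_erase hk).symm, Finset.mem_univ i⟩), hcard,
        smul_eq_mul]
  rw [hsplit, resultant_add_mul_right _ _ _ _ _ (by omega) (hp i), resultant_C_mul_right,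
    ← resultant_prod_right_of_natDegree_le _ (hp i) fun j _ => hp j, hcard]

namespace QuadraticParametrization

variable {a : Fin 4 → K} {v : Fin 4 → F} {p : Fin 4 → K[X]} {u τ : F}

theorem comp {ι κ : Type*} {v : ι → F} {p : ι → K[X]} (hp : QuadraticParametrization v p u τ)
    (f : κ → ι) : QuadraticParametrization (v ∘ f) (p ∘ f) u τ where
  natDegree_le i := hp.natDegree_le (f i)
  eq_mul_aeval i := hp.eq_mul_aeval (f i)

theorem u_ne_zero (hp : QuadraticParametrization v p u τ) (h : VanishingQuadruple a v) : u ≠ 0 :=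
  left_ne_zero_of_mul (hp.eq_mul_aeval 0 ▸ h.ne_zero 0)

theorem aeval_ne_zero (hp : QuadraticParametrization v p u τ) (h : VanishingQuadruple a v)
    (i : Fin 4) : aeval τ (p i) ≠ 0 :=
  right_ne_zero_of_mul (hp.eq_mul_aeval i ▸ h.ne_zero i)

theorem aeval_cayleyNumerator (hp : QuadraticParametrization v p u τ)
    (h : VanishingQuadruple a v) : aeval τ (cayleyNumerator a p) = 0 := by
  have hne := hp.aeval_ne_zero h
  have hsum : ∑ i, algebraMap K F (a i) / aeval τ (p i) = 0 := by
    have := h.sum_div_eq_zero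
    simp only [hp.eq_mul_aeval, ← div_div, div_right_comm _ u, ← Finset.sum_div] at this
    exact (div_eq_zero_iff.1 this).resolve_right (hp.u_ne_zero h)
  calc aeval τ (cayleyNumerator a p)
      = (∏ j, aeval τ (p j)) * ∑ i, algebraMap K F (a i) / aeval τ (p i) := by
        rw [cayleyNumerator, map_sum, Finset.mul_sum]
        refine Finset.sum_congr rfl fun i _ => ?_
        rw [map_mul, aeval_C, map_prod, ← Finset.mul_prod_erase _ _ (Finset.mem_univ i),
          mul_comm, mul_assoc, mul_left_comm, mul_div_cancel₀ _ (hne i)]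
    _ = 0 := by rw [hsum, mul_zero]

variable [CharP K 2]

theorem notMem_range (hp : QuadraticParametrization v p u τ) (hd : finrank K F = 5)
    (h : VanishingQuadruple a v) : τ ∉ (algebraMap K F).range := by
  rintro ⟨t, rfl⟩
  refine h.div_notMem_range hd (i := 1) (j := 0) (by decide) ⟨eval t (p 1) / eval t (p 0), ?_⟩
  rw [hp.eq_mul_aeval, hp.eq_mul_aeval, mul_div_mul_left _ _ (hp.u_ne_zero h),
    aeval_algebraMap_apply_eq_algebraMap_eval, aeval_algebraMap_apply_eq_algebraMap_eval, map_div₀]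

theorem eq_zero_of_aeval_eq_zero (hp : QuadraticParametrization v p u τ) (hd : finrank K F = 5)
    (h : VanishingQuadruple a v) {P : K[X]} (hP : P.natDegree < 5) (h0 : aeval τ P = 0) : P = 0 :=
  eq_zero_of_aeval_eq_zero_of_natDegree_lt (hd ▸ Nat.prime_five) (hp.notMem_range hd h)
    (hd ▸ hP) h0

theorem sum_eq_zero (hp : QuadraticParametrization v p u τ) (hd : finrank K F = 5)
    (h : VanishingQuadruple a v) : ∑ i, p i = 0 := by
  refine hp.eq_zero_of_aeval_eq_zero hd h ((natDegree_sum_le_of_forall_le _ _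
    fun i _ => hp.natDegree_le i).trans_lt (by omega : 2 < 5)) ?_
  have := h.sum_eq_zero
  simp only [hp.eq_mul_aeval, ← Finset.mul_sum] at this
  rw [map_sum]
  exact (mul_eq_zero.1 this).resolve_left (hp.u_ne_zero h)

theorem exists_cayleyNumerator_eq (hp : QuadraticParametrization v p u τ) (hd : finrank K F = 5)
    (h : VanishingQuadruple a v) :
    ∃ L : K[X], L.natDegree ≤ 1 ∧ cayleyNumerator a p = minpoly K τ * L := by
  have : FiniteDimensional K F := .of_finrank_pos (by omega)
  refine exists_eq_minpoly_mul_of_natDegree_le (Algebra.IsIntegral.isIntegral τ) ?_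
    (hp.aeval_cayleyNumerator h)
  rw [natDegree_minpoly_eq_finrank_of_prime (hd ▸ Nat.prime_five) (hp.notMem_range hd h), hd]
  exact natDegree_cayleyNumerator_le a hp.natDegree_le

theorem resultant_cofactor [PerfectField K] (hp : QuadraticParametrization v p u τ)
    (hd : finrank K F = 5) (h : VanishingQuadruple a v) {L : K[X]} (hL : L.natDegree ≤ 1)
    (heq : cayleyNumerator a p = minpoly K τ * L) (i : Fin 4) :
    resultant (p i) L 2 1
      = Algebra.norm K u * ∏ j ∈ Finset.univ.erase i, resultant (p i) (p j) 2 2 := by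
  have : FiniteDimensional K F := .of_finrank_pos (by omega)
  have hprime : (finrank K F).Prime := hd ▸ Nat.prime_five
  have hτ := hp.notMem_range hd h
  have hmin : (minpoly K τ).natDegree ≤ 5 :=
    (natDegree_minpoly_eq_finrank_of_prime hprime hτ).le.trans hd.le
  have hnorm : resultant (p i) (minpoly K τ) 2 5 = Algebra.norm K (aeval τ (p i)) := by
    rw [norm_aeval_eq_resultant_minpoly hprime hτ (hp.natDegree_le i), hd, resultant_comm,
      CharTwo.neg_eq, one_pow, one_mul]
  have hres := resultant_cayleyNumerator a hp.natDegree_le i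
  rw [heq, resultant_mul_right_of_natDegree_le (hp.natDegree_le i) hmin hL, hnorm,
    h.sq_eq_norm, hp.eq_mul_aeval, map_mul] at hres
  refine mul_left_cancel₀ (Algebra.norm_ne_zero_iff.2 (hp.aeval_ne_zero h i)) ?_
  rw [hres]
  ring

end QuadraticParametrization

end VanishingQuadruple

section DegenerateConic

variable {K F : Type*} [Field K] [Field F] [Algebra K F] {a : Fin 4 → K}
  {v : Fin 4 → F} {p : Fin 4 → K[X]} {u τ : F}

theorem prod_erase_univ_fin_four {M : Type*} [CommMonoid M] (f : Fin 4 → M) (i : Fin 4) :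
    ∏ j ∈ Finset.univ.erase i, f j = ![f 1 * (f 2 * f 3), f 0 * (f 2 * f 3), f 0 * (f 1 * f 3),
      f 0 * (f 1 * f 2)] i := by
  have herase : Finset.univ.erase i
      = ![{1, 2, 3}, {0, 2, 3}, {0, 1, 3}, {0, 1, 2}] i := by decide +revert
  rw [herase]
  fin_cases i <;> simp

theorem cayleyNumerator_eq_mul_cayleyQuintic (h₀ : p 0 = X * p 1) :
    cayleyNumerator a p = p 1 * cayleyQuintic a (p 1) (p 2) (p 3) := by
  rw [cayleyNumerator, Fin.sum_univ_four, cayleyQuintic]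
  simp only [prod_erase_univ_fin_four, Matrix.cons_val, h₀]
  ring

namespace QuadraticParametrization

variable [CharP K 2]

theorem apply_three_eq_add (hp : QuadraticParametrization v p u τ) (hd : finrank K F = 5)
    (h : VanishingQuadruple a v) (h₀ : p 0 = X * p 1) : p 3 = p 2 + (X + 1) * p 1 := by
  have hsum := hp.sum_eq_zero hd h
  rw [Fin.sum_univ_four, CharTwo.add_eq_zero] at hsum
  rw [← hsum, h₀]
  ring

theorem resultant_ne_zero (hp : QuadraticParametrization v p u τ) (hd : finrank K F = 5)
    (h : VanishingQuadruple a v) (hL : (p 1).natDegree ≤ 1) (h₀ : p 0 = X * p 1) :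
    resultant (p 2) (p 1) 2 1 ≠ 0 := by
  intro hζ
  obtain ⟨s, t, hst⟩ := exists_eq_linear_mul_of_resultant_eq_zero hL (hp.natDegree_le 2)
    (fun e => hp.aeval_ne_zero h 1 (by rw [e, map_zero])) hζ
  refine (h.comp_perm (Equiv.swap 0 2)).combination_ne hd t s ?_
  change t • v 1 + s • v 0 = v 2
  simp only [hp.eq_mul_aeval, h₀, hst, map_mul, map_add, aeval_C, aeval_X, Algebra.smul_def]
  ring

theorem exists_cayleyQuintic_eq (hp : QuadraticParametrization v p u τ) (hd : finrank K F = 5)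
    (h : VanishingQuadruple a v) (hL : (p 1).natDegree ≤ 1) (h₀ : p 0 = X * p 1) :
    ∃ c, cayleyQuintic a (p 1) (p 2) (p 3) = minpoly K τ * C c := by
  have : FiniteDimensional K F := .of_finrank_pos (by omega)
  have hdeg : (cayleyQuintic a (p 1) (p 2) (p 3)).natDegree ≤ (minpoly K τ).natDegree + 0 := by
    rw [natDegree_minpoly_eq_finrank_of_prime (hd ▸ Nat.prime_five) (hp.notMem_range hd h), hd]
    exact natDegree_cayleyQuintic_le hL (hp.natDegree_le 2) (hp.natDegree_le 3)
  have hroot : aeval τ (cayleyQuintic a (p 1) (p 2) (p 3)) = 0 := by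
    have := hp.aeval_cayleyNumerator h
    rw [cayleyNumerator_eq_mul_cayleyQuintic h₀, map_mul] at this
    exact (mul_eq_zero.1 this).resolve_left (hp.aeval_ne_zero h 1)
  obtain ⟨P, hP, heq⟩ :=
    exists_eq_minpoly_mul_of_natDegree_le (Algebra.IsIntegral.isIntegral τ) hdeg hroot
  exact ⟨P.coeff 0, by rw [heq, ← eq_C_of_natDegree_le_zero hP]⟩

theorem cayleyQuintic_ne_zero (hp : QuadraticParametrization v p u τ) (hd : finrank K F = 5)
    (h : VanishingQuadruple a v) (hL : (p 1).natDegree ≤ 1) (h₀ : p 0 = X * p 1) :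
    cayleyQuintic a (p 1) (p 2) (p 3) ≠ 0 := by
  intro hQ
  have : FiniteDimensional K F := .of_finrank_pos (by omega)
  have hζ := hp.resultant_ne_zero hd h hL h₀
  rw [hp.apply_three_eq_add hd h h₀] at hQ
  rcases eq_and_eq_of_cayleyQuintic_eq_zero h.root_ne_zero hL (hp.natDegree_le 2) hζ hQ with h' | h'
  · exact h.not_roots_eq_and_eq hd h'
  · exact (h.comp_perm (Equiv.swap 2 3)).not_roots_eq_and_eq hd h'

theorem sq_eq_of_cayleyQuintic_eq [PerfectField K] (hp : QuadraticParametrization v p u τ)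
    (hd : finrank K F = 5) (h : VanishingQuadruple a v) (hL : (p 1).natDegree ≤ 1)
    (h₀ : p 0 = X * p 1) {c : K} (hc : cayleyQuintic a (p 1) (p 2) (p 3) = minpoly K τ * C c) :
    c ^ 2 = Algebra.norm K u * resultant (p 2) (p 1) 2 1 ^ 2
      * ((p 2).coeff 0 * (p 2).coeff 2 * ((p 2).coeff 0 + (p 2).coeff 1 + (p 2).coeff 2)) := by
  have hres := hp.resultant_cofactor hd h (L := C c * p 1) ((natDegree_C_mul_le _ _).trans hL)
    (by rw [cayleyNumerator_eq_mul_cayleyQuintic h₀, hc]; ring) 2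
  simp only [prod_erase_univ_fin_four, Matrix.cons_val] at hres
  rw [h₀, hp.apply_three_eq_add hd h h₀,
    resultant_mul_resultant_mul_resultant hL (hp.natDegree_le 2), resultant_C_mul_right] at hres
  refine mul_right_cancel₀ (hp.resultant_ne_zero hd h hL h₀) ?_
  linear_combination hres

theorem coeff_relations_of_cayleyQuintic_eq [PerfectField K]
    (hp : QuadraticParametrization v p u τ) (hd : finrank K F = 5) (h : VanishingQuadruple a v)
    (hL : (p 1).natDegree ≤ 1) (h₀ : p 0 = X * p 1) {c : K}
    (hc : cayleyQuintic a (p 1) (p 2) (p 3) = minpoly K τ * C c) :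
    a 1 * ((p 2).coeff 2 * (p 3).coeff 2) = c ∧
    a 0 * ((p 2).coeff 0 * (p 3).coeff 0) = c * Algebra.norm K τ ∧
    (a 0 * (p 1).coeff 1 + a 1 * (p 1).coeff 0) * resultant (p 2) (p 1) 2 1 ^ 2
      = c * Algebra.norm K (aeval τ (p 1)) := by
  have : FiniteDimensional K F := .of_finrank_pos (by omega)
  have hprime : (finrank K F).Prime := hd ▸ Nat.prime_five
  have hτ := hp.notMem_range hd h
  have hmin := (natDegree_minpoly_eq_finrank_of_prime hprime hτ).trans hd
  have hmonic : (minpoly K τ).coeff 5 = 1 := by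
    rw [← hmin]
    exact minpoly.monic (Algebra.IsIntegral.isIntegral τ)
  have hnormτ : Algebra.norm K τ = (minpoly K τ).coeff 0 := by
    have := norm_aeval_eq_resultant_minpoly hprime hτ (natDegree_X_le (R := K))
    rwa [aeval_X, hd, ← sub_zero X, ← map_zero C, resultant_X_sub_C_right _ _ _ hmin.le,
      CharTwo.neg_eq, one_pow, one_mul, ← coeff_zero_eq_eval_zero] at this
  have hnormL : resultant (p 1) (minpoly K τ) 1 5 = Algebra.norm K (aeval τ (p 1)) := by
    rw [norm_aeval_eq_resultant_minpoly hprime hτ hL, hd, resultant_comm, CharTwo.neg_eq, one_pow,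
      one_mul]
  refine ⟨?_, ?_, ?_⟩
  · rw [← coeff_five_cayleyQuintic hL (hp.natDegree_le 2) (hp.natDegree_le 3), hc, coeff_mul_C,
      hmonic, one_mul]
  · rw [← coeff_zero_cayleyQuintic, hc, coeff_mul_C, hnormτ, mul_comm]
  · rw [← resultant_cayleyQuintic hL (hp.natDegree_le 2), ← hp.apply_three_eq_add hd h h₀, hc,
      ← hnormL, mul_comm (minpoly K τ), resultant_C_mul_right, pow_one]

theorem ne_X_mul [PerfectField K] (hp : QuadraticParametrization v p u τ)
    (hd : finrank K F = 5) (h : VanishingQuadruple a v) (hL : (p 1).natDegree ≤ 1) :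
    p 0 ≠ X * p 1 := by
  intro h₀
  have : FiniteDimensional K F := .of_finrank_pos (by omega)
  obtain ⟨c, hc⟩ := hp.exists_cayleyQuintic_eq hd h hL h₀
  have hc0 : c ≠ 0 := by
    rintro rfl
    exact hp.cayleyQuintic_ne_zero hd h hL h₀ (by rw [hc, map_zero, mul_zero])
  obtain ⟨h₅, hzero, hl⟩ := hp.coeff_relations_of_cayleyQuintic_eq hd h hL h₀ hc
  have hz := hp.sq_eq_of_cayleyQuintic_eq hd h hL h₀ hc
  have hw := (hp.comp (Equiv.swap 2 3)).sq_eq_of_cayleyQuintic_eq hd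
    (h.comp_perm (Equiv.swap 2 3)) hL h₀ (c := c) ((cayleyQuintic_swap a _ _ _).trans hc)
  obtain ⟨w₂, w₁, w₀⟩ := coeffs_add_X_add_one_mul (p 2) hL
  have hζ : resultant (p 3) (p 1) 2 1 = resultant (p 2) (p 1) 2 1 := by
    rw [hp.apply_three_eq_add hd h h₀, resultant_two_one, resultant_two_one, w₂, w₁, w₀]
    grind
  rw [← hp.apply_three_eq_add hd h h₀] at w₀ w₁ w₂
  refine hp.resultant_ne_zero hd h hL h₀ (resultant_eq_zero_of_norm_relations
    (n := Algebra.norm K u) (N := Algebra.norm K τ) (M := Algebra.norm K (aeval τ (p 1)))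
    (h.root_ne_zero 0) (h.root_ne_zero 1) hc0 (resultant_two_one _ _) ?_ ?_ (w₂ ▸ h₅) (w₀ ▸ hzero)
    hl hz ?_)
  · rw [h.sq_eq_norm, hp.eq_mul_aeval, h₀, map_mul, map_mul, map_mul, aeval_X]
  · rw [h.sq_eq_norm, hp.eq_mul_aeval, map_mul]
  · change c ^ 2 = _ * resultant (p 3) (p 1) 2 1 ^ 2
      * ((p 3).coeff 0 * (p 3).coeff 2 * ((p 3).coeff 0 + (p 3).coeff 1 + (p 3).coeff 2)) at hw
    rw [hw, hζ, w₀, w₁, w₂]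
    congr 2
    grind

end QuadraticParametrization

end DegenerateConic

namespace VanishingQuadruple

variable {K F : Type*} [Field K] [Field F] [Algebra K F] [CharP K 2] {a : Fin 4 → K} {v : Fin 4 → F}

theorem quadraticParametrization (h : VanishingQuadruple a v) {τ : F} {L Z : K[X]}
    (hL : L.natDegree ≤ 1) (hZ : Z.natDegree ≤ 2) (hτ : v 0 = τ * v 1)
    (hLτ : aeval τ L ≠ 0) (hv : v 2 * aeval τ L = v 1 * aeval τ Z) :
    QuadraticParametrization v ![X * L, L, Z, Z + (X + 1) * L] (v 1 / aeval τ L) τ := by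
  have h₁ : v 1 = v 1 / aeval τ L * aeval τ L := (div_mul_cancel₀ _ hLτ).symm
  have h₂ : v 2 = v 1 / aeval τ L * aeval τ Z := by
    rw [div_mul_eq_mul_div, ← hv, mul_div_cancel_right₀ _ hLτ]
  have h₃ := h.apply_three
  constructor
  · have hX : (X + 1 : K[X]).natDegree ≤ 1 := natDegree_add_le_of_degree_le natDegree_X_le (by simp)
    rw [Fin.forall_fin_succ, Fin.forall_fin_succ, Fin.forall_fin_two]
    exact ⟨natDegree_mul_le_of_le natDegree_X_le hL, hL.trans one_le_two, hZ,
      natDegree_add_le_of_degree_le hZ (natDegree_mul_le_of_le hX hL)⟩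
  · generalize v 1 / aeval τ L = u at *
    intro i
    fin_cases i <;>
      simp only [Fin.reduceFinMk, Fin.zero_eta, Fin.mk_one, Matrix.cons_val, map_add,
        map_mul, aeval_X, map_one]
    · rw [hτ, h₁]; ring
    · exact h₁
    · exact h₂
    · rw [h₃, hτ, h₂, h₁]; ring

theorem mul_aeval_eq_of_conic_eq_zero (h : VanishingQuadruple a v) {r₀₁ r₀₂ r₀₃ r₁₂ r₁₃ : K}
    (hr : r₀₁ • (v 0 * v 1) + r₀₂ • (v 0 * v 2) + r₀₃ • (v 0 * v 3) + r₁₂ • (v 1 * v 2)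
      + r₁₃ • (v 1 * v 3) = 0) :
    v 2 * aeval (v 0 / v 1) (C (r₀₂ + r₀₃) * X + C (r₁₂ + r₁₃)) =
      v 1 * aeval (v 0 / v 1) (C r₀₃ * X ^ 2 + C (r₀₁ + r₀₃ + r₁₃) * X + C r₁₃) := by
  have : CharP F 2 := charP_of_injective_algebraMap (algebraMap K F).injective 2
  have h1 := h.ne_zero 1
  have hτ : v 0 = v 0 / v 1 * v 1 := (div_mul_cancel₀ _ h1).symm
  simp only [map_add, map_mul, map_pow, aeval_C, aeval_X, Algebra.smul_def] at hr ⊢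
  refine mul_left_cancel₀ h1 ?_
  generalize v 0 / v 1 = τ at *
  rw [h.apply_three, hτ] at hr
  clear * - hr
  grind

theorem conic_coeffs_eq_zero [PerfectField K] (hd : finrank K F = 5)
    (h : VanishingQuadruple a v) {r₀₁ r₀₂ r₀₃ r₁₂ r₁₃ : K}
    (hr : r₀₁ • (v 0 * v 1) + r₀₂ • (v 0 * v 2) + r₀₃ • (v 0 * v 3) + r₁₂ • (v 1 * v 2)
      + r₁₃ • (v 1 * v 3) = 0) :
    r₀₁ = 0 ∧ r₀₂ = 0 ∧ r₀₃ = 0 ∧ r₁₂ = 0 ∧ r₁₃ = 0 := by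
  have h₁ := h.ne_zero 1
  have hτ := h.div_notMem_range hd (i := 0) (j := 1) (by decide)
  have heq := h.mul_aeval_eq_of_conic_eq_zero hr
  have hroot : aeval (v 0 / v 1) (C (r₀₂ + r₀₃) * X + C (r₁₂ + r₁₃)) = 0 := by
    by_contra hL
    exact (h.quadraticParametrization natDegree_linear_le natDegree_quadratic_le
      (div_mul_cancel₀ _ h₁).symm hL heq).ne_X_mul hd h natDegree_linear_le rfl
  have hzero {P : K[X]} (hP : P.natDegree ≤ 2) (h0 : aeval (v 0 / v 1) P = 0) : P = 0 :=
    eq_zero_of_aeval_eq_zero_of_natDegree_lt (hd ▸ Nat.prime_five) hτ (by omega) h0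
  rw [hroot, mul_zero, eq_comm] at heq
  have hL := hzero (natDegree_linear_le.trans one_le_two) hroot
  have hZ := hzero natDegree_quadratic_le ((mul_eq_zero.1 heq).resolve_left h₁)
  have hL₀ : r₁₂ + r₁₃ = 0 := by simpa using congrArg (coeff · 0) hL
  have hL₁ : r₀₂ + r₀₃ = 0 := by simpa using congrArg (coeff · 1) hL
  obtain rfl : r₁₃ = 0 := by simpa using congrArg (coeff · 0) hZ
  obtain rfl : r₀₃ = 0 := by simpa using congrArg (coeff · 2) hZ
  exact ⟨by simpa using congrArg (coeff · 1) hZ, by simpa using hL₁, rfl, by simpa using hL₀, rfl⟩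

end VanishingQuadruple

section ConicInvariants

variable {R : Type*} [CommRing R] [CharP R 2] {p : Fin 4 → R[X]}
  {r : Fin 4 → Fin 4 → R}

theorem apply_three_eq_of_sum_eq_zero (hsum : ∑ i, p i = 0) : p 3 = p 0 + p 1 + p 2 := by
  rw [Fin.sum_univ_four, CharTwo.add_eq_zero] at hsum
  exact hsum.symm

theorem sum_resultant_mul_mul_eq_zero (hp : ∀ i, (p i).natDegree ≤ 2) (hsum : ∑ i, p i = 0)
    (hr : ∀ i j, resultant (p i) (p j) 2 2 = r i j) :
    C (r 2 3) * (p 0 * p 1) + C (r 1 3) * (p 0 * p 2)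
      + C (r 1 2) * (p 0 * p 3) + C (r 0 3) * (p 1 * p 2)
      + C (r 0 2) * (p 1 * p 3) + C (r 0 1) * (p 2 * p 3)
      = 0 := by
  have hquad (i) := eq_quadratic_of_degree_le_two (natDegree_le_iff_degree_le.1 (hp i))
  have h₀ := hquad 0
  have h₁ := hquad 1
  have h₂ := hquad 2
  simp only [← hr, apply_three_eq_of_sum_eq_zero hsum, resultant_two_two, coeff_add,
    map_add, map_mul, map_pow]
  clear hsum hp hquad hr
  generalize (p 0).coeff = x, (p 1).coeff = y, (p 2).coeff = z at *
  rw [h₀, h₁, h₂]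
  clear h₀ h₁ h₂
  generalize C (x 0) = x₀, C (x 1) = x₁, C (x 2) = x₂, C (y 0) = y₀, C (y 1) = y₁, C (y 2) = y₂,
    C (z 0) = z₀, C (z 1) = z₁, C (z 2) = z₂
  grind

theorem sum_resultant_mul_resultant_mul_resultant_eq_zero (L : R[X]) (hsum : ∑ i, p i = 0)
    (hr : ∀ i j, resultant (p i) (p j) 2 2 = r i j) :
    r 2 3 * (resultant (p 0) L 2 1 * resultant (p 1) L 2 1)
      + r 1 3 * (resultant (p 0) L 2 1 * resultant (p 2) L 2 1)
      + r 1 2 * (resultant (p 0) L 2 1 * resultant (p 3) L 2 1)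
      + r 0 3 * (resultant (p 1) L 2 1 * resultant (p 2) L 2 1)
      + r 0 2 * (resultant (p 1) L 2 1 * resultant (p 3) L 2 1)
      + r 0 1 * (resultant (p 2) L 2 1 * resultant (p 3) L 2 1) = 0 := by
  simp only [← hr, apply_three_eq_of_sum_eq_zero hsum, resultant_two_two,
    resultant_two_one, coeff_add]
  clear hsum hr
  generalize (p 0).coeff = x, (p 1).coeff = y, (p 2).coeff = z, L.coeff = l
  grind

theorem sum_resultant_eq_zero (L : R[X]) (hsum : ∑ i, p i = 0) :
    ∑ i, resultant (p i) L 2 1 = 0 := by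
  rw [Fin.sum_univ_four]
  simp only [apply_three_eq_of_sum_eq_zero hsum, resultant_two_one, coeff_add]
  clear hsum
  grind

theorem resultant_add_resultant_add_resultant (f g h : R[X]) :
    resultant f g 2 2 + resultant f h 2 2 + resultant f (f + g + h) 2 2
      = (f.coeff 2 * g.coeff 1 + f.coeff 1 * g.coeff 2)
          * (f.coeff 1 * h.coeff 0 + f.coeff 0 * h.coeff 1)
        + (f.coeff 2 * h.coeff 1 + f.coeff 1 * h.coeff 2)
          * (f.coeff 1 * g.coeff 0 + f.coeff 0 * g.coeff 1) := by
  simp only [resultant_two_two, coeff_add]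
  grind

theorem half_discriminant_eq (x₀ x₁ x₂ y₀ y₁ y₂ z₀ z₁ z₂ : R) :
    (x₁ ^ 2 + x₂ * x₀) * (y₂ * z₀ + y₀ * z₂) ^ 2 + (y₁ ^ 2 + y₂ * y₀) * (x₂ * z₀ + x₀ * z₂) ^ 2
      + (z₁ ^ 2 + z₂ * z₀) * (x₂ * y₀ + x₀ * y₂) ^ 2
      + (x₂ * y₀ + x₀ * y₂) * (x₂ * z₀ + x₀ * z₂) * (y₂ * z₀ + y₀ * z₂)
      = (!![x₀, x₁, x₂; y₀, y₁, y₂; z₀, z₁, z₂].det) ^ 2 := by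
  rw [Matrix.det_fin_three]
  simp only [Matrix.of_apply, Matrix.cons_val]
  grind

theorem det_minors_eq (x y z : ℕ → R) :
    !![y 1 * z 0 + y 0 * z 1, y 2 * z 0 + y 0 * z 2, y 2 * z 1 + y 1 * z 2;
       x 1 * z 0 + x 0 * z 1, x 2 * z 0 + x 0 * z 2, x 2 * z 1 + x 1 * z 2;
       x 1 * y 0 + x 0 * y 1, x 2 * y 0 + x 0 * y 2, x 2 * y 1 + x 1 * y 2].det
      = !![x 0, x 1, x 2; y 0, y 1, y 2; z 0, z 1, z 2].det ^ 2 := by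
  simp only [Matrix.det_fin_three, Matrix.of_apply, Matrix.cons_val]
  grind

theorem det_pow_four_eq (hsum : ∑ i, p i = 0) (hr : ∀ i j, resultant (p i) (p j) 2 2 = r i j) :
    !![(p 0).coeff 0, (p 0).coeff 1, (p 0).coeff 2;
       (p 1).coeff 0, (p 1).coeff 1, (p 1).coeff 2;
       (p 2).coeff 0, (p 2).coeff 1, (p 2).coeff 2].det ^ 4
      = (r 1 2 * r 0 3 + r 0 2 * r 1 3 + r 0 1 * r 2 3)
          * (r 0 1 + r 0 2 + r 0 3 + r 1 2 + r 1 3 + r 2 3)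
        + (r 0 1 * r 0 2 * r 0 3 + r 0 1 * r 1 2 * r 1 3 + r 0 2 * r 1 2 * r 2 3
          + r 0 3 * r 1 3 * r 2 3) := by
  have hcomm (i j) : r i j = r j i := by
    rw [← hr, ← hr, resultant_comm, CharTwo.neg_eq, one_pow, one_mul]
  have h₀ := resultant_add_resultant_add_resultant (p 0) (p 1) (p 2)
  have h₁ := resultant_add_resultant_add_resultant (p 1) (p 0) (p 2)
  have h₂ := resultant_add_resultant_add_resultant (p 2) (p 0) (p 1)
  rw [← apply_three_eq_of_sum_eq_zero hsum, hr, hr, hr] at h₀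
  rw [add_comm (p 1), ← apply_three_eq_of_sum_eq_zero hsum, hr, hr, hr, hcomm 1 0] at h₁
  rw [add_assoc (p 2), add_comm (p 2), ← apply_three_eq_of_sum_eq_zero hsum, hr, hr, hr,
    hcomm 2 0, hcomm 2 1] at h₂
  calc _ = (!![(p 0).coeff 0, (p 0).coeff 1, (p 0).coeff 2;
          (p 1).coeff 0, (p 1).coeff 1, (p 1).coeff 2;
          (p 2).coeff 0, (p 2).coeff 1, (p 2).coeff 2].det ^ 2) ^ 2 := by rw [← pow_mul]
    _ = r 1 2 * (r 0 1 + r 0 2 + r 0 3) ^ 2 + r 0 2 * (r 0 1 + r 1 2 + r 1 3) ^ 2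
          + r 0 1 * (r 0 2 + r 1 2 + r 2 3) ^ 2
          + (r 0 1 + r 0 2 + r 0 3) * (r 0 1 + r 1 2 + r 1 3) * (r 0 2 + r 1 2 + r 2 3) := by
      rw [h₀, h₁, h₂, ← det_minors_eq, ← half_discriminant_eq, ← hr, ← hr, ← hr,
        resultant_two_two, resultant_two_two, resultant_two_two]
      ring
    _ = _ := by
      clear * -
      grind

end ConicInvariants

theorem combination_eq_zero_of_vecMul_coeff_eq_zero {R : Type*} [CommRing R] {f g h : R[X]}
    (hf : f.natDegree ≤ 2) (hg : g.natDegree ≤ 2) (hh : h.natDegree ≤ 2) {c : Fin 3 → R}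
    (hc : Matrix.vecMul c !![f.coeff 0, f.coeff 1, f.coeff 2; g.coeff 0, g.coeff 1, g.coeff 2;
      h.coeff 0, h.coeff 1, h.coeff 2] = 0) :
    C (c 0) * f + C (c 1) * g + C (c 2) * h = 0 := by
  have hdeg : (C (c 0) * f + C (c 1) * g + C (c 2) * h).natDegree ≤ 2 :=
    natDegree_add_le_of_degree_le (natDegree_add_le_of_degree_le
      ((natDegree_C_mul_le _ _).trans hf) ((natDegree_C_mul_le _ _).trans hg))
      ((natDegree_C_mul_le _ _).trans hh)
  have h₀ := congrFun hc 0
  have h₁ := congrFun hc 1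
  have h₂ := congrFun hc 2
  simp only [Matrix.vecMul, dotProduct, Fin.sum_univ_three, Matrix.of_apply, Matrix.cons_val,
    Pi.zero_apply] at h₀ h₁ h₂
  rw [eq_quadratic_of_degree_le_two (natDegree_le_iff_degree_le.1 hdeg)]
  simp only [coeff_add, coeff_C_mul, h₀, h₁, h₂, map_zero, zero_mul, add_zero]

namespace QuadraticParametrization

variable {K F : Type*} [Field K] [Field F] [Algebra K F] [CharP K 2] {a : Fin 4 → K}
  {v : Fin 4 → F} {p : Fin 4 → K[X]} {u τ : F}

theorem det_coeff_ne_zero (hp : QuadraticParametrization v p u τ) (hd : finrank K F = 5)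
    (h : VanishingQuadruple a v) :
    !![(p 0).coeff 0, (p 0).coeff 1, (p 0).coeff 2;
       (p 1).coeff 0, (p 1).coeff 1, (p 1).coeff 2;
       (p 2).coeff 0, (p 2).coeff 1, (p 2).coeff 2].det ≠ 0 := by
  intro hdet
  obtain ⟨c, hc, hcp⟩ := Matrix.exists_vecMul_eq_zero_iff.2 hdet
  have haeval := congrArg (aeval τ) (combination_eq_zero_of_vecMul_coeff_eq_zero
    (hp.natDegree_le 0) (hp.natDegree_le 1) (hp.natDegree_le 2) hcp)
  simp only [map_add, map_mul, aeval_C, map_zero] at haeval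
  have hindep := h.linearIndependent hd
  rw [Fintype.linearIndependent_iff] at hindep
  refine hc (funext (hindep c ?_))
  simp only [Fin.sum_univ_three, Matrix.cons_val, hp.eq_mul_aeval, Algebra.smul_def]
  linear_combination u * haeval

theorem conic_eq_zero (hp : QuadraticParametrization v p u τ) (hd : finrank K F = 5)
    (h : VanishingQuadruple a v) {r : Fin 4 → Fin 4 → K}
    (hr : ∀ i j, resultant (p i) (p j) 2 2 = r i j) :
    r 2 3 • (v 0 * v 1) + r 1 3 • (v 0 * v 2) + r 1 2 • (v 0 * v 3) + r 0 3 • (v 1 * v 2)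
      + r 0 2 • (v 1 * v 3) + r 0 1 • (v 2 * v 3) = 0 := by
  have hconic := congrArg (aeval τ) (sum_resultant_mul_mul_eq_zero hp.natDegree_le
    (hp.sum_eq_zero hd h) hr)
  simp only [map_add, map_mul, aeval_C, map_zero] at hconic
  simp only [hp.eq_mul_aeval, Algebra.smul_def]
  linear_combination u ^ 2 * hconic

variable [PerfectField K]

theorem resultant_zero_one_ne_zero (hp : QuadraticParametrization v p u τ) (hd : finrank K F = 5)
    (h : VanishingQuadruple a v) : resultant (p 0) (p 1) 2 2 ≠ 0 := by
  intro h₀₁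
  have hconic := hp.conic_eq_zero hd h fun _ _ => rfl
  rw [h₀₁, zero_smul, add_zero] at hconic
  obtain ⟨h₂₃, h₁₃, h₁₂, h₀₃, h₀₂⟩ := h.conic_coeffs_eq_zero hd hconic
  have hdet := det_pow_four_eq (hp.sum_eq_zero hd h) fun _ _ => rfl
  simp only [h₀₁, h₂₃, h₁₃, h₁₂, h₀₃, h₀₂, mul_zero, add_zero] at hdet
  exact hp.det_coeff_ne_zero hd h (eq_zero_of_pow_eq_zero hdet)

theorem resultant_pair_ne_zero (hp : QuadraticParametrization v p u τ) (hd : finrank K F = 5)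
    (h : VanishingQuadruple a v) {i j : Fin 4} (hij : i ≠ j) : resultant (p i) (p j) 2 2 ≠ 0 := by
  obtain ⟨σ, rfl, rfl⟩ := exists_perm_apply_eq_of_ne i j hij
  exact (hp.comp σ).resultant_zero_one_ne_zero hd (h.comp_perm σ)

theorem not_vanishingQuadruple (hp : QuadraticParametrization v p u τ) (hd : finrank K F = 5) :
    ¬ VanishingQuadruple a v := by
  intro h
  have : FiniteDimensional K F := .of_finrank_pos (by omega)
  obtain ⟨L, hL, heq⟩ := hp.exists_cayleyNumerator_eq hd h
  obtain ⟨r, hr⟩ : ∃ r : Fin 4 → Fin 4 → K, ∀ i j, resultant (p i) (p j) 2 2 = r i j :=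
    ⟨_, fun _ _ => rfl⟩
  have hr0 {i j : Fin 4} (hij : i ≠ j) : r i j ≠ 0 := hr i j ▸ hp.resultant_pair_ne_zero hd h hij
  have hcomm (i j) : r i j = r j i := by
    rw [← hr, ← hr, resultant_comm, CharTwo.neg_eq, one_pow, one_mul]
  have hcof (i) := hp.resultant_cofactor hd h hL heq i
  have hu : Algebra.norm K u ≠ 0 := Algebra.norm_ne_zero_iff.2 (hp.u_ne_zero h)
  have hlin := sum_resultant_eq_zero L (hp.sum_eq_zero hd h)
  have hquad := sum_resultant_mul_resultant_mul_resultant_eq_zero L (hp.sum_eq_zero hd h) hr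
  have hdet := det_pow_four_eq (hp.sum_eq_zero hd h) hr
  rw [Fin.sum_univ_four] at hlin
  simp only [hcof, hr, prod_erase_univ_fin_four, Matrix.cons_val, hcomm 1 0, hcomm 2 0, hcomm 3 0,
    hcomm 2 1, hcomm 3 1, hcomm 3 2] at hlin hquad
  have htriples : r 0 1 * r 0 2 * r 0 3 + r 0 1 * r 1 2 * r 1 3 + r 0 2 * r 1 2 * r 2 3
      + r 0 3 * r 1 3 * r 2 3 = 0 := by
    refine (mul_eq_zero.1 ?_).resolve_left hu
    linear_combination hlin
  have hpairs : r 0 1 + r 0 2 + r 0 3 + r 1 2 + r 1 3 + r 2 3 = 0 := by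
    refine (mul_eq_zero.1 ?_).resolve_left (?_ : Algebra.norm K u ^ 2
      * (r 0 1 * r 0 2 * r 0 3 * r 1 2 * r 1 3 * r 2 3) ≠ 0)
    · linear_combination hquad
    · simp [hu, hr0]
  rw [htriples, hpairs, mul_zero, add_zero] at hdet
  exact hp.det_coeff_ne_zero hd h (eq_zero_of_pow_eq_zero hdet)

end QuadraticParametrization

section ConicParametrization

variable {K F ι : Type*} [Field K] [Field F] [Algebra K F]

theorem QuadraticParametrization.combination {κ : Type*} [Fintype ι] {v : ι → F} {p : ι → K[X]}
    {u τ : F} (hp : QuadraticParametrization v p u τ) {w : κ → F} {c : κ → ι → K}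
    (hw : ∀ j, w j = ∑ i, c j i • v i) :
    QuadraticParametrization w (fun j => ∑ i, C (c j i) * p i) u τ where
  natDegree_le j := natDegree_sum_le_of_forall_le _ _ fun i _ =>
    (natDegree_C_mul_le _ _).trans (hp.natDegree_le i)
  eq_mul_aeval j := by
    simp only [hw, map_sum, map_mul, aeval_C, Finset.mul_sum, hp.eq_mul_aeval, Algebra.smul_def]
    exact Finset.sum_congr rfl fun i _ => mul_left_comm _ _ _

theorem exists_quadraticParametrization_of_comp_equiv {κ : Type*} {v : ι → F} (σ : κ ≃ ι)
    (h : ∃ (p : κ → K[X]) (u τ : F), QuadraticParametrization (v ∘ σ) p u τ) :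
    ∃ (p : ι → K[X]) (u τ : F), QuadraticParametrization v p u τ := by
  obtain ⟨p, u, τ, hp⟩ := h
  have hp' := hp.comp σ.symm
  rw [Function.comp_assoc, σ.self_comp_symm, Function.comp_id] at hp'
  exact ⟨_, u, τ, hp'⟩

theorem exists_quadraticParametrization_of_sq_eq_mul {v : Fin 3 → F} (hv : v 0 ≠ 0) {α β γ k : K}
    (hk : k ≠ 0) (hγ : γ ≠ 0) (h : (α • v 0 + β • v 1 + γ • v 2) ^ 2 = k • (v 0 * v 1)) :
    ∃ (p : Fin 3 → K[X]) (u τ : F), QuadraticParametrization v p u τ := by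
  obtain ⟨τ, hτ⟩ : ∃ τ, τ * v 0 = α • v 0 + β • v 1 + γ • v 2 := ⟨_, div_mul_cancel₀ _ hv⟩
  have hk' := (map_ne_zero (algebraMap K F)).2 hk
  have hγ' := (map_ne_zero (algebraMap K F)).2 hγ
  rw [← hτ] at h
  simp only [Algebra.smul_def] at h hτ
  have h₁ : algebraMap K F k * v 1 = v 0 * τ ^ 2 :=
    mul_left_cancel₀ hv (by linear_combination -h)
  have h₂ : algebraMap K F γ * v 2
      = v 0 * (τ - algebraMap K F α - algebraMap K F (β * k⁻¹) * τ ^ 2) := by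
    rw [map_mul, map_inv₀]
    field_simp
    linear_combination -algebraMap K F k * hτ - algebraMap K F β * h₁
  refine ⟨![1, C k⁻¹ * X ^ 2, C γ⁻¹ * (X - C α - C (β * k⁻¹) * X ^ 2)], v 0, τ,
    Fin.forall_fin_succ.2 ⟨?_, Fin.forall_fin_two.2 ⟨?_, ?_⟩⟩,
    Fin.forall_fin_succ.2 ⟨?_, Fin.forall_fin_two.2 ⟨?_, ?_⟩⟩⟩
  · exact natDegree_one.trans_le zero_le_two
  · exact natDegree_C_mul_X_pow_le _ _
  · refine (natDegree_C_mul_le _ _).trans ?_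
    compute_degree
  · simp
  · simp only [Fin.succ_zero_eq_one, Matrix.cons_val, map_mul, map_pow, aeval_C, aeval_X, map_inv₀]
    field_simp
    linear_combination h₁
  · simp only [Fin.succ_one_eq_two, Matrix.cons_val, map_mul, map_sub, map_pow, aeval_C, aeval_X,
      map_inv₀] at h₂ ⊢
    field_simp at h₂ ⊢
    linear_combination h₂

theorem exists_sq_eq [CharP K 2] [PerfectField K] (c : K) : ∃ r : K, r ^ 2 = c :=
  have := PerfectField.toPerfectRing (K := K) 2
  surjective_frobenius K 2 c

variable [CharP K 2] [PerfectField K] {v : Fin 3 → F} {a b c f g k : K}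

theorem exists_quadraticParametrization_of_diagonal_add_mixed (hp : (finrank K F).Prime)
    (hd : 3 < finrank K F) (hv : LinearIndependent K v) (hk : k ≠ 0)
    (h : a • v 0 ^ 2 + b • v 1 ^ 2 + c • v 2 ^ 2 + k • (v 0 * v 1) = 0) :
    ∃ (p : Fin 3 → K[X]) (u τ : F), QuadraticParametrization v p u τ := by
  have : CharP F 2 := charP_of_injective_algebraMap (algebraMap K F).injective 2
  obtain ⟨α, rfl⟩ := exists_sq_eq a
  obtain ⟨β, rfl⟩ := exists_sq_eq b
  obtain ⟨γ, rfl⟩ := exists_sq_eq c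
  have hv₀ := hv.ne_zero 0
  have hsq : (α • v 0 + β • v 1 + γ • v 2) ^ 2 = k • (v 0 * v 1) := by
    rw [CharTwo.add_sq, CharTwo.add_sq, _root_.smul_pow, _root_.smul_pow, _root_.smul_pow]
    exact CharTwo.add_eq_zero.1 h
  refine exists_quadraticParametrization_of_sq_eq_mul hv₀ hk ?_ hsq
  rintro rfl
  have hr : v 1 / v 0 ∉ (algebraMap K F).range := by
    rintro ⟨s, hs⟩
    rw [Fintype.linearIndependent_iff] at hv
    refine neg_ne_zero.2 one_ne_zero (hv ![s, -1, 0] ?_ 1)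
    simp [Fin.sum_univ_three, Algebra.smul_def, hs, hv₀]
  refine hk (coeffs_eq_zero_of_cubic_eq_zero (a := 0) (b := β ^ 2) (c := k) (d := α ^ 2) hp hd hr
    ?_).2.2.1
  simp only [Algebra.smul_def, zero_pow two_ne_zero, map_zero, zero_mul, add_zero] at h ⊢
  field_simp
  linear_combination h

theorem exists_quadraticParametrization_of_mixed_ne_zero (hp : (finrank K F).Prime)
    (hd : 3 < finrank K F) (hv : LinearIndependent K v) (hk : k ≠ 0)
    (h : a • v 0 ^ 2 + b • v 1 ^ 2 + c • v 2 ^ 2 + f • (v 1 * v 2) + g • (v 0 * v 2)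
      + k • (v 0 * v 1) = 0) :
    ∃ (p : Fin 3 → K[X]) (u τ : F), QuadraticParametrization v p u τ := by
  have : CharP F 2 := charP_of_injective_algebraMap (algebraMap K F).injective 2
  obtain ⟨f, rfl⟩ : ∃ f', k * f' = f := ⟨_, mul_div_cancel₀ _ hk⟩
  obtain ⟨g, rfl⟩ : ∃ g', k * g' = g := ⟨_, mul_div_cancel₀ _ hk⟩
  let w : Fin 3 → F := ![v 0 + f • v 2, v 1 + g • v 2, v 2]
  have hw : LinearIndependent K w := by
    rw [Fintype.linearIndependent_iff] at hv ⊢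
    intro d hsum
    have hd' := hv ![d 0, d 1, d 2 + d 0 * f + d 1 * g] (by
      simp only [w, Fin.sum_univ_three, Matrix.cons_val] at hsum ⊢
      simp only [Algebra.smul_def, map_add, map_mul] at hsum ⊢
      linear_combination hsum)
    have h₀ : d 0 = 0 := hd' 0
    have h₁ : d 1 = 0 := hd' 1
    have h₂ : d 2 + d 0 * f + d 1 * g = 0 := hd' 2
    refine Fin.forall_fin_succ.2 ⟨h₀, Fin.forall_fin_two.2 ⟨h₁, ?_⟩⟩
    simpa [h₀, h₁] using h₂
  obtain ⟨_, u, τ, hp⟩ := exists_quadraticParametrization_of_diagonal_add_mixed (a := a) (b := b)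
    (c := c + a * f ^ 2 + b * g ^ 2 + k * (f * g)) hp hd hw hk (by
      simp only [w, Matrix.cons_val, Algebra.smul_def, map_add, map_mul, map_pow] at h ⊢
      clear * - h this
      grind)
  refine ⟨_, u, τ, hp.combination (c := ![![1, 0, f], ![0, 1, g], ![0, 0, 1]]) fun i => ?_⟩
  fin_cases i <;> simp [w, Fin.sum_univ_three, add_assoc, CharTwo.add_self_eq_zero]

theorem exists_quadraticParametrization_of_conic (hp : (finrank K F).Prime)
    (hd : 3 < finrank K F) (hv : LinearIndependent K v) (hne : ![a, b, c, f, g, k] ≠ 0)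
    (h : a • v 0 ^ 2 + b • v 1 ^ 2 + c • v 2 ^ 2 + f • (v 1 * v 2) + g • (v 0 * v 2)
      + k • (v 0 * v 1) = 0) :
    ∃ (p : Fin 3 → K[X]) (u τ : F), QuadraticParametrization v p u τ := by
  rcases ne_or_eq k 0 with hk | rfl
  · exact exists_quadraticParametrization_of_mixed_ne_zero hp hd hv hk h
  rcases ne_or_eq g 0 with hg | rfl
  · refine exists_quadraticParametrization_of_comp_equiv (Equiv.swap 1 2)
      (exists_quadraticParametrization_of_mixed_ne_zero (a := a) (b := c) (c := b) (f := f)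
        (g := 0) hp hd (hv.comp _ (Equiv.injective _)) hg ?_)
    have e₀ : Equiv.swap 1 2 (0 : Fin 3) = 0 := by decide
    simp only [Function.comp_apply, e₀, Equiv.swap_apply_left, Equiv.swap_apply_right,
      Algebra.smul_def] at h ⊢
    linear_combination h
  rcases ne_or_eq f 0 with hf | rfl
  · refine exists_quadraticParametrization_of_comp_equiv (finRotate 3)
      (exists_quadraticParametrization_of_mixed_ne_zero (a := b) (b := c) (c := a) (f := 0)
        (g := 0) hp hd (hv.comp _ (Equiv.injective _)) hf ?_)
    have e₀ : finRotate 3 0 = 1 := by decide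
    have e₁ : finRotate 3 1 = 2 := by decide
    have e₂ : finRotate 3 2 = 0 := by decide
    simp only [Function.comp_apply, e₀, e₁, e₂, Algebra.smul_def] at h ⊢
    linear_combination h
  have : FiniteDimensional K F := .of_finrank_pos hp.pos
  have hsq := hv.map_pow_expChar_pow_of_isSeparable 2 1
  rw [Fintype.linearIndependent_iff] at hsq
  have h₀ := hsq ![a, b, c] (by simpa [Fin.sum_univ_three] using h)
  refine absurd ?_ hne
  rw [show a = 0 from h₀ 0, show b = 0 from h₀ 1, show c = 0 from h₀ 2]
  simp

theorem exists_conic_of_finrank_lt_six {K F : Type*} [Field K] [Field F] [Algebra K F]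
    [FiniteDimensional K F] (hd : finrank K F < 6) (v : Fin 3 → F) :
    ∃ a b c f g k : K, ![a, b, c, f, g, k] ≠ 0 ∧ a • v 0 ^ 2 + b • v 1 ^ 2 + c • v 2 ^ 2
      + f • (v 1 * v 2) + g • (v 0 * v 2) + k • (v 0 * v 1) = 0 := by
  have hdep : ¬ LinearIndependent K
      ![v 0 ^ 2, v 1 ^ 2, v 2 ^ 2, v 1 * v 2, v 0 * v 2, v 0 * v 1] := fun hli =>
    (hli.fintype_card_le_finrank.trans_lt hd).ne (Fintype.card_fin 6)
  rw [Fintype.not_linearIndependent_iff] at hdep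
  obtain ⟨d, hsum, i, hi⟩ := hdep
  refine ⟨d 0, d 1, d 2, d 3, d 4, d 5, fun h => hi ?_, ?_⟩
  · fin_cases i
    exacts [congrFun h 0, congrFun h 1, congrFun h 2, congrFun h 3, congrFun h 4, congrFun h 5]
  · simpa only [Fin.sum_univ_six, Matrix.cons_val] using hsum

end ConicParametrization

theorem VanishingQuadruple.exists_quadraticParametrization {K F : Type*} [Field K] [Field F]
    [Algebra K F] [CharP K 2] [PerfectField K] {a : Fin 4 → K} {v : Fin 4 → F}
    (hd : finrank K F = 5) (h : VanishingQuadruple a v) :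
    ∃ (p : Fin 4 → K[X]) (u τ : F), QuadraticParametrization v p u τ := by
  have : FiniteDimensional K F := .of_finrank_pos (by omega)
  obtain ⟨_, _, _, _, _, _, hne, hconic⟩ :=
    exists_conic_of_finrank_lt_six (by omega : finrank K F < 6) ![v 0, v 1, v 2]
  obtain ⟨p, u, τ, hp⟩ := exists_quadraticParametrization_of_conic (hd ▸ Nat.prime_five) (by omega)
    (h.linearIndependent hd) hne hconic
  refine ⟨_, u, τ, hp.combination
    (c := ![![1, 0, 0], ![0, 1, 0], ![0, 0, 1], ![1, 1, 1]]) fun i => ?_⟩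
  fin_cases i <;> simp [Fin.sum_univ_three, h.apply_three]

theorem not_vanishingQuadruple {K F : Type*} [Field K] [Field F] [Algebra K F] [CharP K 2]
    [PerfectField K] (hd : finrank K F = 5) (a : Fin 4 → K) (v : Fin 4 → F) :
    ¬ VanishingQuadruple a v := fun h =>
  have ⟨_, _, _, hp⟩ := h.exists_quadraticParametrization hd
  hp.not_vanishingQuadruple hd h

section NormDivSq

variable {K F : Type*} [Field K] [Field F] [Algebra K F]

variable (K) in
/-- The function `x ↦ N(x) / x ^ 2`, where `N` is the norm from `F` to `K`. When `K` is finite and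
`F` has degree five over `K` it is the Dobbertin power function. -/
noncomputable def normDivSq (x : F) : F :=
  algebraMap K F (Algebra.norm K x) / x ^ 2

theorem normDivSq_zero : normDivSq K (0 : F) = 0 := by
  rw [normDivSq, zero_pow two_ne_zero, div_zero]

theorem normDivSq_ne_zero [FiniteDimensional K F] {x : F} (hx : x ≠ 0) : normDivSq K x ≠ 0 :=
  div_ne_zero ((map_ne_zero (algebraMap K F)).2 (Algebra.norm_ne_zero_iff.2 hx)) (pow_ne_zero 2 hx)

theorem normDivSq_algebraMap_mul (hd : finrank K F = 5) (c : K) (x : F) :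
    normDivSq K (algebraMap K F c * x) = algebraMap K F c ^ 3 * normDivSq K x := by
  rcases eq_or_ne c 0 with rfl | hc
  · simp [normDivSq_zero]
  have hc' := (map_ne_zero (algebraMap K F)).2 hc
  rw [normDivSq, normDivSq, map_mul, Algebra.norm_algebraMap, hd, mul_pow, map_mul, map_pow]
  field_simp

theorem norm_normDivSq (hd : finrank K F = 5) (x : F) :
    Algebra.norm K (normDivSq K x) = Algebra.norm K x ^ 3 := by
  have : FiniteDimensional K F := .of_finrank_pos (by omega)
  rcases eq_or_ne x 0 with rfl | hx
  · rw [normDivSq_zero, Algebra.norm_zero, zero_pow three_ne_zero]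
  refine mul_right_cancel₀ (pow_ne_zero 2 (Algebra.norm_ne_zero_iff.2 hx)) ?_
  rw [← map_pow _ x, ← map_mul, normDivSq, div_mul_cancel₀ _ (pow_ne_zero 2 hx),
    Algebra.norm_algebraMap, hd, map_pow, ← pow_add]

theorem sq_notMem_range (hprime : (finrank K F).Prime) (hd : 3 < finrank K F) {x : F}
    (hx : x ∉ (algebraMap K F).range) : x ^ 2 ∉ (algebraMap K F).range := by
  rintro ⟨c, hc⟩
  refine one_ne_zero (coeffs_eq_zero_of_cubic_eq_zero (a := 0) (b := 1) (c := 0) (d := -c)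
    hprime hd hx ?_).2.1
  simp [hc]

theorem mem_range_of_normDivSq_mem_range (hd : finrank K F = 5) {x : F}
    (h : normDivSq K x ∈ (algebraMap K F).range) : x ∈ (algebraMap K F).range := by
  have : FiniteDimensional K F := .of_finrank_pos (by omega)
  by_contra hx
  have hx₀ : x ≠ 0 := by
    rintro rfl
    exact hx (zero_mem _)
  obtain ⟨c, hc⟩ := h
  refine sq_notMem_range (hd ▸ Nat.prime_five) (by omega) hx ⟨Algebra.norm K x / c, ?_⟩
  rw [map_div₀, hc, normDivSq, div_div_cancel₀]
  exact (map_ne_zero (algebraMap K F)).2 (Algebra.norm_ne_zero_iff.2 hx₀)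

variable [CharP K 2]

theorem normDivSq_injective (hd : finrank K F = 5)
    (hcube : Function.Injective fun c : K => c ^ 3) :
    Function.Injective (normDivSq K : F → F) := by
  have : CharP F 2 := charP_of_injective_algebraMap (algebraMap K F).injective 2
  have : FiniteDimensional K F := .of_finrank_pos (by omega)
  intro x y h
  have hN : Algebra.norm K x = Algebra.norm K y :=
    hcube (by simpa only [norm_normDivSq hd] using congrArg (Algebra.norm K) h)
  rcases eq_or_ne x 0 with rfl | hx
  · rw [Algebra.norm_zero] at hN
    exact (Algebra.norm_eq_zero_iff.1 hN.symm).symm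
  have hN₀ := (map_ne_zero (algebraMap K F)).2 (Algebra.norm_ne_zero_iff.2 hx)
  rw [normDivSq, normDivSq, ← hN, div_eq_mul_inv, div_eq_mul_inv] at h
  exact CharTwo.sq_injective (inv_injective (mul_left_cancel₀ hN₀ h))

theorem eq_zero_of_normDivSq_add_normDivSq_mem_range (hd : finrank K F = 5) {x : F}
    (hx : x ∉ (algebraMap K F).range) {e : K}
    (h : normDivSq K (x + algebraMap K F e) + normDivSq K x ∈ (algebraMap K F).range) : e = 0 := by
  have : CharP F 2 := charP_of_injective_algebraMap (algebraMap K F).injective 2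
  have : FiniteDimensional K F := .of_finrank_pos (by omega)
  have hx₀ : x ≠ 0 := fun h₀ => hx (h₀ ▸ zero_mem _)
  have hxe : x + algebraMap K F e ≠ 0 := fun h₀ => hx ⟨e, (CharTwo.add_eq_zero.1 h₀).symm⟩
  obtain ⟨c, hc⟩ := h
  have hquad := coeffs_eq_zero_of_cubic_eq_zero (a := 0) (b := c)
    (c := c * e ^ 2 + Algebra.norm K x + Algebra.norm K (x + algebraMap K F e))
    (d := Algebra.norm K x * e ^ 2) (hd ▸ Nat.prime_five) (by omega)
    (sq_notMem_range (hd ▸ Nat.prime_five) (by omega) hx) (by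
      rw [normDivSq, normDivSq, div_add_div _ _ (pow_ne_zero 2 hxe) (pow_ne_zero 2 hx₀),
        eq_div_iff (mul_ne_zero (pow_ne_zero 2 hxe) (pow_ne_zero 2 hx₀)), CharTwo.add_sq] at hc
      simp only [map_add, map_mul, map_pow, map_zero]
      clear * - hc this
      grind)
  exact pow_eq_zero_iff two_ne_zero |>.1
    ((mul_eq_zero.1 hquad.2.2.2).resolve_left (Algebra.norm_ne_zero_iff.2 hx₀))

variable [PerfectField K]

theorem exists_sq_eq_norm_and_sum_div_eq_zero {ι : Type*} [Fintype ι] {v : ι → F}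
    (h : ∑ i, normDivSq K (v i) = 0) :
    ∃ a : ι → K, (∀ i, a i ^ 2 = Algebra.norm K (v i)) ∧ ∑ i, algebraMap K F (a i) / v i = 0 := by
  have : CharP F 2 := charP_of_injective_algebraMap (algebraMap K F).injective 2
  choose a ha using fun i => exists_sq_eq (Algebra.norm K (v i))
  refine ⟨a, ha, eq_zero_of_pow_eq_zero (n := 2) ?_⟩
  rw [CharTwo.sum_sq]
  simpa only [div_pow, ← map_pow, ha, normDivSq] using h

theorem normDivSq_add_normDivSq_add_normDivSq_ne_zero (hd : finrank K F = 5) {x y : F}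
    (hx : x ≠ 0) (hy : y ≠ 0) (hxy : x ≠ y) :
    normDivSq K x + normDivSq K y + normDivSq K (x + y) ≠ 0 := by
  have : CharP F 2 := charP_of_injective_algebraMap (algebraMap K F).injective 2
  have : FiniteDimensional K F := .of_finrank_pos (by omega)
  have hadd : x + y ≠ 0 := fun h₀ => hxy (CharTwo.add_eq_zero.1 h₀)
  obtain ⟨r, rfl⟩ : ∃ r, y = r * x := ⟨y / x, (div_mul_cancel₀ _ hx).symm⟩
  have hr : r ≠ 0 := left_ne_zero_of_mul hy
  have hr₁ : 1 + r ≠ 0 := left_ne_zero_of_mul (b := x) (by rwa [add_mul, one_mul])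
  intro h
  by_cases hmem : r ∈ (algebraMap K F).range
  · obtain ⟨t, rfl⟩ := hmem
    have hshift : x + algebraMap K F t * x = algebraMap K F (1 + t) * x := by
      rw [map_add, map_one, add_mul, one_mul]
    rw [hshift, normDivSq_algebraMap_mul hd, normDivSq_algebraMap_mul hd, map_add, map_one] at h
    refine mul_ne_zero (mul_ne_zero hr hr₁) (normDivSq_ne_zero (K := K) hx) ?_
    clear * - h this
    grind
  · obtain ⟨a, ha, hsum⟩ := exists_sq_eq_norm_and_sum_div_eq_zero
      (v := ![x, r * x, x + r * x]) (by simpa only [Fin.sum_univ_three, Matrix.cons_val] using h)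
    have hquad := coeffs_eq_zero_of_cubic_eq_zero (a := 0) (b := a 0) (c := a 0 + a 1 + a 2)
      (d := a 1) (hd ▸ Nat.prime_five) (by omega) hmem (by
        have hfactor : x + r * x = (1 + r) * x := by ring
        simp only [Fin.sum_univ_three, Matrix.cons_val, hfactor] at hsum
        field_simp at hsum
        simp only [map_add, map_zero]
        linear_combination hsum)
    refine Algebra.norm_ne_zero_iff.2 hy ((ha 1).symm.trans ?_)
    rw [hquad.2.2.2, zero_pow two_ne_zero]

theorem sum_normDivSq_ne_zero (hd : finrank K F = 5) {v : Fin 4 → F} (hv : Function.Injective v)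
    (hsum : ∑ i, v i = 0) : ∑ i, normDivSq K (v i) ≠ 0 := by
  have : CharP F 2 := charP_of_injective_algebraMap (algebraMap K F).injective 2
  intro h
  by_cases hne : ∀ i, v i ≠ 0
  · obtain ⟨a, ha, hdiv⟩ := exists_sq_eq_norm_and_sum_div_eq_zero h
    exact not_vanishingQuadruple hd a v ⟨hv, hne, hsum, ha, hdiv⟩
  push Not at hne
  obtain ⟨i, hi⟩ := hne
  let w := v ∘ Equiv.swap 0 i
  have hw : Function.Injective w := hv.comp (Equiv.injective _)
  have hw₀ : w 0 = 0 := by simp [w, hi]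
  have hwsum : ∑ j, w j = 0 := (Equiv.sum_comp (Equiv.swap 0 i) v).trans hsum
  have hwval : ∑ j, normDivSq K (w j) = 0 :=
    (Equiv.sum_comp (Equiv.swap 0 i) fun j => normDivSq K (v j)).trans h
  rw [Fin.sum_univ_four, hw₀, zero_add] at hwsum
  rw [Fin.sum_univ_four, hw₀, normDivSq_zero, zero_add,
    ← CharTwo.add_eq_zero.1 hwsum] at hwval
  exact normDivSq_add_normDivSq_add_normDivSq_ne_zero hd (hw₀ ▸ hw.ne (by decide))
    (hw₀ ▸ hw.ne (by decide)) (hw.ne (by decide)) hwval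

theorem eq_or_eq_add_of_normDivSq_add_eq (hd : finrank K F = 5) {x y a : F} (ha : a ≠ 0)
    (h : normDivSq K (x + a) + normDivSq K x = normDivSq K (y + a) + normDivSq K y) :
    y = x ∨ y = x + a := by
  have : CharP F 2 := charP_of_injective_algebraMap (algebraMap K F).injective 2
  by_contra! hne
  have hinj : Function.Injective ![x, x + a, y, y + a] := by
    simp only [Function.Injective, Fin.forall_fin_succ, IsEmpty.forall_iff, Fin.succ_zero_eq_one,
      Fin.succ_one_eq_two, Fin.reduceSucc, Matrix.cons_val]
    grind
  refine sum_normDivSq_ne_zero (K := K) hd hinj ?_ ?_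
  · simp only [Fin.sum_univ_four, Matrix.cons_val]
    clear * - this
    grind
  · simp only [Fin.sum_univ_four, Matrix.cons_val]
    rw [← CharTwo.add_eq_zero] at h
    linear_combination h

end NormDivSq

section PowerPermutation

variable {K : Type*} [Field K] [CharP K 2]

theorem eq_zero_or_eq_one_of_pow_two_pow_eq {i j : ℕ} (hij : i.Coprime j) {x : K}
    (hi : x ^ 2 ^ i = x) (hj : x ^ 2 ^ j = x) : x = 0 ∨ x = 1 := by
  have hperiodic {n : ℕ} (hn : x ^ 2 ^ n = x) : Function.IsPeriodicPt (frobenius K 2) n x := by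
    rw [Function.IsPeriodicPt, Function.IsFixedPt, iterate_frobenius, hn]
  have hfixed : Function.IsPeriodicPt (frobenius K 2) 1 x :=
    hij ▸ (hperiodic hi).gcd (hperiodic hj)
  have hsq : x ^ 2 = x := hfixed
  exact IsIdempotentElem.iff_eq_zero_or_one.1 ((pow_two x).symm.trans hsq)

theorem two_pow_sub_one_ne_zero {m : ℕ} (hm : m ≠ 0) : 2 ^ m - 1 ≠ 0 :=
  Nat.sub_ne_zero_of_lt (Nat.one_lt_two_pow hm)

theorem pow_two_pow_sub_one_injective [Fintype K] {k m : ℕ} (hK : Fintype.card K = 2 ^ k)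
    (hmk : m.Coprime k) (hm : m ≠ 0) : Function.Injective fun x : K => x ^ (2 ^ m - 1) := by
  intro x y h
  dsimp only at h
  rcases eq_or_ne y 0 with rfl | hy
  · rwa [zero_pow (two_pow_sub_one_ne_zero hm), pow_eq_zero_iff (two_pow_sub_one_ne_zero hm)] at h
  have hdiv : (x / y) ^ (2 ^ m - 1) = 1 := by
    rw [div_pow, h, div_self (pow_ne_zero _ hy)]
  have hfixed : (x / y) ^ 2 ^ m = x / y := by
    rw [← Nat.sub_add_cancel (Nat.one_le_two_pow (n := m)), pow_succ, hdiv, one_mul]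
  rcases eq_zero_or_eq_one_of_pow_two_pow_eq hmk hfixed (hK ▸ FiniteField.pow_card _) with h₀ | h₁
  · rw [h₀, zero_pow (two_pow_sub_one_ne_zero hm)] at hdiv
    exact absurd hdiv zero_ne_one
  · exact (div_eq_one_iff_eq hy).1 h₁

theorem cube_injective [Fintype K] {k : ℕ} (hk : Odd k) (hK : Fintype.card K = 2 ^ k) :
    Function.Injective fun x : K => x ^ 3 :=
  pow_two_pow_sub_one_injective hK hk.coprime_two_left two_ne_zero

theorem pow_two_pow_add_self (m : ℕ) (x : K) :
    x ^ 2 ^ m + x = ((x + 1) ^ (2 ^ m - 1) + x ^ (2 ^ m - 1)) * (x ^ 2 + x) := by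
  have hsucc (y : K) : y ^ 2 ^ m = y ^ (2 ^ m - 1) * y := by
    rw [← pow_succ, Nat.sub_add_cancel Nat.one_le_two_pow]
  have hadd := add_pow_char_pow x 1 (p := 2) (n := m)
  rw [one_pow, hsucc, hsucc x] at hadd
  rw [hsucc]
  generalize (x + 1) ^ (2 ^ m - 1) = u at *
  generalize x ^ (2 ^ m - 1) = v at *
  linear_combination -x * hadd - v * x ^ 2 * CharTwo.two_eq_zero (R := K)

theorem sq_add_self_eq_zero_iff {x : K} : x ^ 2 + x = 0 ↔ x = 0 ∨ x = 1 := by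
  rw [pow_two, ← mul_add_one, mul_eq_zero, CharTwo.add_eq_zero]

theorem eq_or_eq_add_one_of_sq_add_self_eq {x y : K} (h : x ^ 2 + x = y ^ 2 + y) :
    y = x ∨ y = x + 1 := by
  have hroots : (y - x) * (y - (x + 1)) = 0 := by
    linear_combination -h + (x ^ 2 + x - x * y - y) * CharTwo.two_eq_zero (R := K)
  simpa only [mul_eq_zero, sub_eq_zero] using hroots

theorem sq_add_self_eq_of_pow_four_add_self_eq {b x : K} (hx : x ^ 2 + x ≠ 0)
    (h : x ^ 4 + x = b * (x ^ 2 + x)) : x ^ 2 + x = b + 1 := by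
  refine mul_right_cancel₀ hx ?_
  linear_combination h + (x ^ 3 - x) * CharTwo.two_eq_zero (R := K)

theorem mul_sq_add_self_eq_one_of_sq_root {b x y : K} (hx : x ^ 2 + x ≠ 0) (hy : y ^ 2 = x)
    (h : y + x = b * (x ^ 2 + x)) : b ^ 2 * (x ^ 2 + x) = 1 := by
  refine mul_right_cancel₀ hx ?_
  rw [one_mul]
  have hsq := congrArg (· ^ 2) h
  simp only [CharTwo.add_sq, hy] at hsq
  linear_combination -hsq

theorem mul_sq_add_self_eq_of_map_map_eq_sq {b x : K} (σ : K →+* K) (hσ : σ (σ x) = x ^ 2)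
    (hx : x ^ 2 + x ≠ 0) (h : σ x + x = b * (x ^ 2 + x)) :
    σ b * b ^ 2 * (x ^ 2 + x) = 1 + b + σ b * (1 + b) := by
  refine mul_right_cancel₀ hx ?_
  have hσx : σ x = x + b * (x ^ 2 + x) := by
    rw [← h, add_comm (σ x), CharTwo.add_cancel_left]
  have hmap := congrArg σ hσx
  rw [hσ, map_add, map_mul, map_add, map_pow, hσx] at hmap
  generalize σ b = e at *
  clear * - hmap
  grind

theorem exists_forall_sq_add_self_eq [Fintype K] {k m : ℕ} (hK : Fintype.card K = 2 ^ k)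
    (hk : Odd k) (hm : m = k - 1 ∨ m = (k + 1) / 2 ∨ m = 2) {b : K} (hb : b ≠ 0) :
    ∃ c : K, ∀ x, x ^ 2 + x ≠ 0 → x ^ 2 ^ m + x = b * (x ^ 2 + x) → x ^ 2 + x = c := by
  have hcard (x : K) : x ^ 2 ^ k = x := hK ▸ FiniteField.pow_card x
  obtain ⟨j, rfl⟩ := hk
  rcases hm with rfl | rfl | rfl
  · refine ⟨1 / b ^ 2, fun x hx h => ?_⟩
    rw [eq_div_iff (pow_ne_zero 2 hb), mul_comm]
    exact mul_sq_add_self_eq_one_of_sq_root hx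
      (by rw [← pow_mul, ← pow_succ, Nat.add_sub_cancel, hcard]) h
  · rw [show (2 * j + 1 + 1) / 2 = j + 1 by omega]
    let σ := iterateFrobenius K 2 (j + 1)
    have hσ (x : K) : σ x = x ^ 2 ^ (j + 1) := iterateFrobenius_def 2 (j + 1) x
    refine ⟨(1 + b + σ b * (1 + b)) / (σ b * b ^ 2), fun x hx h => ?_⟩
    rw [eq_div_iff (mul_ne_zero ((map_ne_zero σ).2 hb) (pow_ne_zero 2 hb)), mul_comm]
    refine mul_sq_add_self_eq_of_map_map_eq_sq σ ?_ hx (by rwa [hσ])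
    rw [hσ, hσ, ← pow_mul, ← pow_add, show j + 1 + (j + 1) = 2 * j + 1 + 1 by ring, pow_succ,
      pow_mul, hcard]
  · exact ⟨b + 1, fun x hx h => sq_add_self_eq_of_pow_four_add_self_eq hx h⟩

theorem coprime_and_pred_coprime {k m : ℕ} (hk : Odd k)
    (hm : m = k - 1 ∨ m = (k + 1) / 2 ∨ m = 2) (hm₀ : 0 < m) :
    m.Coprime k ∧ (m - 1).Coprime k := by
  obtain ⟨j, rfl⟩ := hk
  simp only [← Nat.isCoprime_iff_coprime]
  rcases hm with rfl | rfl | rfl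
  · obtain ⟨i, rfl⟩ : ∃ i, j = i + 1 := ⟨j - 1, by omega⟩
    rw [Nat.add_sub_cancel, show 2 * (i + 1) - 1 = 2 * i + 1 by omega]
    refine ⟨⟨-1, 1, ?_⟩, ⟨i + 1, -i, ?_⟩⟩ <;> push_cast <;> ring
  · rw [show (2 * j + 1 + 1) / 2 = j + 1 by omega, Nat.add_sub_cancel]
    refine ⟨⟨2, -1, ?_⟩, ⟨-2, 1, ?_⟩⟩ <;> push_cast <;> ring
  · refine ⟨⟨-j, 1, ?_⟩, ⟨1, 0, ?_⟩⟩ <;> push_cast <;> ring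

section

variable [Fintype K] {k m : ℕ}

theorem pow_two_pow_sub_one_add_eq_one_iff (hK : Fintype.card K = 2 ^ k)
    (hmk : (m - 1).Coprime k) (hm : m ≠ 0) {x : K} :
    (x + 1) ^ (2 ^ m - 1) + x ^ (2 ^ m - 1) = 1 ↔ x ^ 2 + x = 0 := by
  constructor
  · intro h
    have hx := pow_two_pow_add_self m x
    rw [h, one_mul, add_left_inj, ← Nat.sub_add_cancel (Nat.one_le_iff_ne_zero.2 hm), pow_succ,
      pow_mul] at hx
    exact sq_add_self_eq_zero_iff.2 (eq_zero_or_eq_one_of_pow_two_pow_eq hmk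
      (CharTwo.sq_injective hx) (hK ▸ FiniteField.pow_card x))
  · rw [sq_add_self_eq_zero_iff]
    rintro (rfl | rfl) <;> simp [two_pow_sub_one_ne_zero hm, CharTwo.add_self_eq_zero]

theorem eq_or_eq_add_one_of_pow_two_pow_sub_one_add_eq (hK : Fintype.card K = 2 ^ k) (hk : Odd k)
    (hm : m = k - 1 ∨ m = (k + 1) / 2 ∨ m = 2) (hm₀ : 0 < m) {x y : K}
    (h : (x + 1) ^ (2 ^ m - 1) + x ^ (2 ^ m - 1) = (y + 1) ^ (2 ^ m - 1) + y ^ (2 ^ m - 1)) :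
    y = x ∨ y = x + 1 := by
  obtain ⟨hmk, hpred⟩ := coprime_and_pred_coprime hk hm hm₀
  refine eq_or_eq_add_one_of_sq_add_self_eq ?_
  have hone {z : K} := pow_two_pow_sub_one_add_eq_one_iff hK hpred hm₀.ne' (x := z)
  have hx := pow_two_pow_add_self m x
  have hy := pow_two_pow_add_self m y
  by_cases hx₁ : x ^ 2 + x = 0
  · rw [hx₁, hone.1 (h.symm.trans (hone.2 hx₁))]
  have hy₁ : y ^ 2 + y ≠ 0 := fun hy₁ => hx₁ (hone.1 (h.trans (hone.2 hy₁)))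
  rw [← h] at hy
  have hb : (x + 1) ^ (2 ^ m - 1) + x ^ (2 ^ m - 1) ≠ 0 := by
    intro hb
    rw [hb, zero_mul, CharTwo.add_eq_zero] at hx
    exact hx₁ (sq_add_self_eq_zero_iff.2
      (eq_zero_or_eq_one_of_pow_two_pow_eq hmk hx (hK ▸ FiniteField.pow_card x)))
  obtain ⟨c, hc⟩ := exists_forall_sq_add_self_eq hK hk hm hb
  rw [hc x hx₁ hx, hc y hy₁ hy]

theorem eq_or_eq_add_of_pow_two_pow_sub_one_add_eq (hK : Fintype.card K = 2 ^ k) (hk : Odd k)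
    (hm : m = k - 1 ∨ m = (k + 1) / 2 ∨ m = 2) (hm₀ : 0 < m) {x y a : K} (ha : a ≠ 0)
    (h : (x + a) ^ (2 ^ m - 1) + x ^ (2 ^ m - 1) = (y + a) ^ (2 ^ m - 1) + y ^ (2 ^ m - 1)) :
    y = x ∨ y = x + a := by
  obtain ⟨s, rfl⟩ : ∃ s, x = s * a := ⟨x / a, (div_mul_cancel₀ x ha).symm⟩
  obtain ⟨t, rfl⟩ : ∃ t, y = t * a := ⟨y / a, (div_mul_cancel₀ y ha).symm⟩
  simp only [← add_one_mul, mul_pow, ← add_mul] at h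
  rcases eq_or_eq_add_one_of_pow_two_pow_sub_one_add_eq hK hk hm hm₀
    (mul_right_cancel₀ (pow_ne_zero _ ha) h) with rfl | rfl
  · exact .inl rfl
  · exact .inr (add_one_mul s a)

end

end PowerPermutation

section DifferentialUniformity

theorem ncard_le_two_of_forall_eq_or_eq_add {α : Type*} [Add α] {S : Set α} (a : α)
    (h : ∀ x ∈ S, ∀ y ∈ S, y = x ∨ y = x + a) : S.ncard ≤ 2 := by
  rcases S.eq_empty_or_nonempty with rfl | ⟨x, hx⟩
  · simp
  · exact (Set.ncard_le_ncard (t := {x, x + a}) (h x hx)).trans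
      (by simpa using Set.ncard_insert_le x {x + a})

variable {F : Type*} [Field F] [Fintype F]

theorem isDifferentiallyUniform_iff {δ : ℕ} {f : F → F} :
    IsDifferentiallyUniform δ f ↔ ∀ a ≠ 0, ∀ b, {x | f (x + a) + f x = b}.ncard ≤ δ := by
  simp only [IsDifferentiallyUniform, differentialUniformity, Finset.sup_le_iff,
    Finset.mem_filter_univ, Prod.forall]
  exact ⟨fun h a ha b => h a b ha, fun h a b ha => h a ha b⟩

theorem isDifferentiallyUniform_two_of_forall_eq_or_eq_add {f : F → F}
    (h : ∀ x y a, a ≠ 0 → f (x + a) + f x = f (y + a) + f y → y = x ∨ y = x + a) :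
    IsDifferentiallyUniform 2 f :=
  isDifferentiallyUniform_iff.2 fun a ha _ =>
    ncard_le_two_of_forall_eq_or_eq_add a fun x hx y hy => h x y a ha (hx.trans hy.symm)

theorem IsDifferentiallyUniform.two_le [CharP F 2] {δ : ℕ} {f : F → F}
    (h : IsDifferentiallyUniform δ f) : 2 ≤ δ := by
  refine le_trans ?_ (isDifferentiallyUniform_iff.1 h 1 one_ne_zero (f 1 + f 0))
  rw [← Set.ncard_pair (zero_ne_one (α := F))]
  refine Set.ncard_le_ncard (Set.pair_subset ?_ ?_)
  · simp
  · simp [CharTwo.add_self_eq_zero, add_comm]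

theorem IsDifferentiallyUniform.affineEquiv_comp_comp [Algebra (ZMod 2) F] {δ : ℕ} {f : F → F}
    (h : IsDifferentiallyUniform δ f) (L₁ L₂ : F ≃ᵃ[ZMod 2] F) :
    IsDifferentiallyUniform δ (L₁ ∘ f ∘ L₂) := by
  have : CharP F 2 := charP_of_injective_algebraMap (algebraMap (ZMod 2) F).injective 2
  refine isDifferentiallyUniform_iff.2 fun a ha b => ?_
  have hL₂ (x : F) : L₂ (x + a) = L₂ x + L₂.linear a := by
    simpa only [vadd_eq_add, add_comm] using L₂.map_vadd x a
  have hL₁ (u v : F) : L₁ u + L₁ v = L₁.linear (u + v) := by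
    rw [← CharTwo.sub_eq_add, ← CharTwo.sub_eq_add]
    exact (L₁.toAffineMap.linearMap_vsub u v).symm
  refine (Set.ncard_le_ncard_of_injOn L₂ ?_ L₂.injective.injOn).trans
    (isDifferentiallyUniform_iff.1 h (L₂.linear a) (by simpa using ha) (L₁.linear.symm b))
  intro x hx
  simp only [Set.mem_ofPred_eq, Function.comp_apply, hL₁, hL₂] at hx
  exact (L₁.linear.eq_symm_apply).2 hx

end DifferentialUniformity

section ModifiedDobbertin

variable {K F : Type*} [Field K] [Field F] [Algebra K F]

theorem pow_dobbertinExp_eq_normDivSq [Finite F] {k : ℕ} (hK : Nat.card K = 2 ^ k)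
    (hd : finrank K F = 5) (x : F) : x ^ dobbertinExp k = normDivSq K x := by
  have hlt : 1 < 2 ^ (4 * k) + 2 ^ (3 * k) + 2 ^ (2 * k) + 2 ^ k := by
    linarith [Nat.two_pow_pos (4 * k), Nat.two_pow_pos (3 * k), Nat.two_pow_pos (2 * k),
      Nat.two_pow_pos k]
  have hexp : dobbertinExp k + 2 = ∑ i ∈ Finset.range (finrank K F), Nat.card K ^ i := by
    simp only [hd, hK, dobbertinExp, Finset.sum_range_succ, Finset.sum_range_zero, ← pow_mul,
      mul_comm k, zero_mul, one_mul, pow_zero]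
    omega
  have hne : dobbertinExp k ≠ 0 := Nat.sub_ne_zero_of_lt hlt
  rcases eq_or_ne x 0 with rfl | hx
  · rw [normDivSq_zero, zero_pow hne]
  · rw [normDivSq, FiniteField.algebraMap_norm_eq_pow_sum, ← hexp,
      eq_div_iff (pow_ne_zero 2 hx), pow_add]

theorem mem_range_algebraMap_iff_pow_card_eq [Fintype K] [Finite F] {x : F} :
    x ∈ (algebraMap K F).range ↔ x ^ Fintype.card K = x := by
  constructor
  · rintro ⟨c, rfl⟩
    rw [← map_pow, FiniteField.pow_card]
  · intro hx
    refine (IsGalois.mem_range_algebraMap_iff_fixed x).2 fun σ => ?_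
    obtain ⟨n, rfl⟩ := (FiniteField.bijective_frobeniusAlgEquivOfAlgebraic_pow K F).2 σ
    rw [AlgEquiv.coe_pow]
    have hfix : Function.IsFixedPt (FiniteField.frobeniusAlgEquivOfAlgebraic K F) x := hx
    exact hfix.iterate n

section

variable [CharP F 2] {k : ℕ} {g : F → F} {x : F}

theorem modifiedDobbertin_of_pow_eq (hk : k ≠ 0) (hx : x ^ 2 ^ k = x) :
    modifiedDobbertin k g x = g x := by
  rw [modifiedDobbertin, hx, CharTwo.add_self_eq_zero,
    zero_pow (two_pow_sub_one_ne_zero (mul_ne_zero (by norm_num) hk)), mul_zero, add_zero]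

theorem modifiedDobbertin_of_pow_ne [Fintype F] (hF : Fintype.card F = 2 ^ (5 * k))
    (hx : x ^ 2 ^ k ≠ x) : modifiedDobbertin k g x = x ^ dobbertinExp k := by
  have hsum : x + x ^ 2 ^ k ≠ 0 := fun h => hx (CharTwo.add_eq_zero.1 h).symm
  rw [modifiedDobbertin, ← hF, FiniteField.pow_card_sub_one_eq_one _ hsum, mul_one,
    CharTwo.add_cancel_left]

end

variable {h : K → K} {f : F → F}

theorem injective_of_eq_normDivSq [CharP K 2] (hd : finrank K F = 5)
    (hcube : Function.Injective fun c : K => c ^ 3) (hh : Function.Injective h)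
    (hin : ∀ c, f (algebraMap K F c) = algebraMap K F (h c))
    (hout : ∀ x ∉ (algebraMap K F).range, f x = normDivSq K x) : Function.Injective f := by
  have hmixed {c : K} {x : F} (hx : x ∉ (algebraMap K F).range) : f (algebraMap K F c) ≠ f x := by
    intro hcx
    rw [hin, hout x hx] at hcx
    exact hx (mem_range_of_normDivSq_mem_range hd ⟨h c, hcx⟩)
  intro x y hxy
  by_cases hx : x ∈ (algebraMap K F).range <;> by_cases hy : y ∈ (algebraMap K F).range
  · obtain ⟨c, rfl⟩ := hx
    obtain ⟨e, rfl⟩ := hy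
    rw [hin, hin] at hxy
    rw [hh ((algebraMap K F).injective hxy)]
  · obtain ⟨c, rfl⟩ := hx
    exact absurd hxy (hmixed hy)
  · obtain ⟨c, rfl⟩ := hy
    exact absurd hxy.symm (hmixed hx)
  · rw [hout x hx, hout y hy] at hxy
    exact normDivSq_injective hd hcube hxy

variable {a b : F}

theorem subsingleton_add_eq_and_mem_range [CharP K 2] (hd : finrank K F = 5)
    (ha : a ∉ (algebraMap K F).range) (hin : ∀ c, f (algebraMap K F c) ∈ (algebraMap K F).range)
    (hout : ∀ x ∉ (algebraMap K F).range, f x = normDivSq K x) :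
    {x | f (x + a) + f x = b ∧ x ∈ (algebraMap K F).range}.Subsingleton := by
  have : CharP F 2 := charP_of_injective_algebraMap (algebraMap K F).injective 2
  have hadd (c : K) : algebraMap K F c + a ∉ (algebraMap K F).range := fun hmem =>
    ha ((add_mem_cancel_left (RingHom.mem_range_self _ c)).1 hmem)
  rintro _ ⟨hc, c, rfl⟩ _ ⟨he, e, rfl⟩
  obtain ⟨s, hs⟩ := hin c
  obtain ⟨t, ht⟩ := hin e
  rw [hout _ (hadd c), ← hs] at hc
  rw [hout _ (hadd e), ← ht] at he
  have hshift : algebraMap K F c + a + algebraMap K F (c + e) = algebraMap K F e + a := by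
    rw [map_add, add_right_comm, CharTwo.add_cancel_left]
  have hce := eq_zero_of_normDivSq_add_normDivSq_mem_range (e := c + e) hd (hadd c) ⟨s + t, by
    rw [hshift, map_add]
    clear * - hc he this
    grind⟩
  rw [CharTwo.add_eq_zero.1 hce]

theorem ncard_add_eq_and_notMem_range_le_two [CharP K 2] [PerfectField K] (hd : finrank K F = 5)
    (ha : a ≠ 0) (hout : ∀ x ∉ (algebraMap K F).range, f x = normDivSq K x) :
    {x | f (x + a) + f x = b ∧ x ∉ (algebraMap K F).range ∧
      x + a ∉ (algebraMap K F).range}.ncard ≤ 2 := by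
  refine ncard_le_two_of_forall_eq_or_eq_add a ?_
  rintro x ⟨hx, hx₁, hx₂⟩ y ⟨hy, hy₁, hy₂⟩
  rw [hout _ hx₁, hout _ hx₂] at hx
  rw [hout _ hy₁, hout _ hy₂] at hy
  exact eq_or_eq_add_of_normDivSq_add_eq hd ha (hx.trans hy.symm)

theorem ncard_add_algebraMap_eq_and_mem_range_le [Fintype K] {δ : ℕ}
    (hh : IsDifferentiallyUniform δ h) (hin : ∀ c, f (algebraMap K F c) = algebraMap K F (h c))
    {e : K} (he : e ≠ 0) :
    {x | f (x + algebraMap K F e) + f x = b ∧ x ∈ (algebraMap K F).range}.ncard ≤ δ := by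
  by_cases hb : b ∈ (algebraMap K F).range
  · obtain ⟨t, rfl⟩ := hb
    refine le_trans (Set.ncard_le_ncard (t := algebraMap K F '' {c | h (c + e) + h c = t}) ?_)
      ((Set.ncard_image_le).trans (isDifferentiallyUniform_iff.1 hh e he t))
    rintro _ ⟨hc, c, rfl⟩
    rw [← map_add, hin, hin, ← map_add] at hc
    exact ⟨c, (algebraMap K F).injective hc, rfl⟩
  · rw [Set.eq_empty_of_forall_notMem (s := {x | _}), Set.ncard_empty]
    · exact δ.zero_le
    rintro _ ⟨hc, c, rfl⟩
    rw [← map_add, hin, hin, ← map_add] at hc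
    exact hb ⟨_, hc⟩

theorem isDifferentiallyUniform_of_eq_normDivSq [Fintype K] [Fintype F] [CharP K 2] {δ : ℕ}
    (hd : finrank K F = 5) (hh : IsDifferentiallyUniform δ h)
    (hin : ∀ c, f (algebraMap K F c) = algebraMap K F (h c))
    (hout : ∀ x ∉ (algebraMap K F).range, f x = normDivSq K x) :
    IsDifferentiallyUniform (δ + 2) f := by
  have : CharP F 2 := charP_of_injective_algebraMap (algebraMap K F).injective 2
  refine isDifferentiallyUniform_iff.2 fun a ha b => ?_
  let R := (algebraMap K F).range
  let inside := {x | f (x + a) + f x = b ∧ x ∈ R}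
  let outside := {x | f (x + a) + f x = b ∧ x ∉ R ∧ x + a ∉ R}
  have houtside : outside.ncard ≤ 2 := ncard_add_eq_and_notMem_range_le_two hd ha hout
  by_cases haR : a ∈ R
  · obtain ⟨e, rfl⟩ := haR
    have hinside : inside.ncard ≤ δ :=
      ncard_add_algebraMap_eq_and_mem_range_le hh hin (by rintro rfl; simp at ha)
    refine (Set.ncard_le_ncard (t := inside ∪ outside) fun x hx => ?_).trans
      ((Set.ncard_union_le _ _).trans (Nat.add_le_add hinside houtside))
    by_cases hxR : x ∈ R
    · exact .inl ⟨hx, hxR⟩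
    · exact .inr ⟨hx, hxR, fun hmem =>
        hxR ((add_mem_cancel_right (RingHom.mem_range_self _ e)).1 hmem)⟩
  · have hinside : inside.Subsingleton :=
      subsingleton_add_eq_and_mem_range hd haR (fun c => ⟨h c, (hin c).symm⟩) hout
    have hshifted : ((· + a) ⁻¹' inside).Subsingleton :=
      hinside.preimage (add_left_injective a)
    refine (Set.ncard_le_ncard (t := inside ∪ (· + a) ⁻¹' inside ∪ outside) fun x hx => ?_).trans
      ((Set.ncard_union_le _ _).trans (Nat.add_le_add ?_ houtside))
    · by_cases hxR : x ∈ R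
      · exact .inl (.inl ⟨hx, hxR⟩)
      by_cases hxaR : x + a ∈ R
      · refine .inl (.inr ⟨?_, hxaR⟩)
        rwa [CharTwo.add_cancel_right, add_comm (f x)]
      · exact .inr ⟨hx, hxR, hxaR⟩
    · exact (Set.ncard_union_le _ _).trans
        ((Nat.add_le_add (Set.ncard_le_one_iff_subsingleton.2 hinside)
          (Set.ncard_le_one_iff_subsingleton.2 hshifted)).trans hh.two_le)

end ModifiedDobbertin

theorem mainTheorem3_general {k δ : ℕ} (hk : Odd k) {K F : Type*} [Field K] [Fintype K] [Field F]
    [Fintype F] [Algebra K F] (hK : Fintype.card K = 2 ^ k) (hF : Fintype.card F = 2 ^ (5 * k))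
    {h : K → K} (hbij : Function.Bijective h) (hunif : IsDifferentiallyUniform δ h) {g : F → F}
    (hg : ∀ x : K, g (algebraMap K F x) = algebraMap K F (h x)) :
    Function.Bijective (modifiedDobbertin k g) ∧
      IsDifferentiallyUniform (δ + 2) (modifiedDobbertin k g) := by
  have : CharP K 2 := charP_of_card_eq_prime_pow hK
  have : CharP F 2 := charP_of_card_eq_prime_pow hF
  have hd : finrank K F = 5 := by
    refine Nat.pow_right_injective (Fintype.one_lt_card (α := K)) ?_
    dsimp only
    rw [← Module.card_eq_pow_finrank, hF, hK, ← pow_mul, mul_comm]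
  have hin (c : K) : modifiedDobbertin k g (algebraMap K F c) = algebraMap K F (h c) := by
    rw [modifiedDobbertin_of_pow_eq hk.pos.ne', hg]
    exact hK ▸ mem_range_algebraMap_iff_pow_card_eq.1 ⟨c, rfl⟩
  have hout (x : F) (hx : x ∉ (algebraMap K F).range) :
      modifiedDobbertin k g x = normDivSq K x := by
    rw [mem_range_algebraMap_iff_pow_card_eq, hK] at hx
    rw [modifiedDobbertin_of_pow_ne hF hx,
      pow_dobbertinExp_eq_normDivSq (Nat.card_eq_fintype_card.trans hK) hd]
  exact ⟨Finite.injective_iff_bijective.1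
      (injective_of_eq_normDivSq hd (cube_injective hk hK) hbij.injective hin hout),
    isDifferentiallyUniform_of_eq_normDivSq hd hunif hin hout⟩

/-- `K` is the subfield with `2 ^ k` elements of the field `F` with `2 ^ n = 2 ^ (5 * k)` elements,
and `g` is any function on `F` (for example the one given by a polynomial over `K`) that on `K` is
`L₁ ∘ x ^ (2 ^ m - 1) ∘ L₂` with affine permutations `L₁`, `L₂` of `K`. The condition `0 < m` only
excludes `k = 1`, `m = k - 1 = 0`. -/
theorem mainTheorem3 (k m : ℕ) (hk : Odd k)
    (hm : m = k - 1 ∨ m = (k + 1) / 2 ∨ m = 2) (hm0 : 0 < m)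
    (K F : Type*) [Field K] [Fintype K] [Field F] [Fintype F] [Algebra K F] [Algebra (ZMod 2) K]
    (hK : Fintype.card K = 2 ^ k) (hF : Fintype.card F = 2 ^ (5 * k))
    (L₁ L₂ : K ≃ᵃ[ZMod 2] K) (g : F → F)
    (hg : ∀ x : K, g (algebraMap K F x) = algebraMap K F (L₁ ((L₂ x) ^ (2 ^ m - 1)))) :
    Function.Bijective (modifiedDobbertin k g) ∧
      IsDifferentiallyUniform 4 (modifiedDobbertin k g) := by
  have : CharP K 2 := charP_of_card_eq_prime_pow hK
  exact mainTheorem3_general hk hK hF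
    (L₁.bijective.comp ((Finite.injective_iff_bijective.1 (pow_two_pow_sub_one_injective hK
      (coprime_and_pred_coprime hk hm hm0).1 hm0.ne')).comp L₂.bijective))
    ((isDifferentiallyUniform_two_of_forall_eq_or_eq_add fun _ _ _ =>
      eq_or_eq_add_of_pow_two_pow_sub_one_add_eq hK hk hm hm0).affineEquiv_comp_comp L₁ L₂) hg
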